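/- Let $k$ be an algebraically closed field (of any characteristic). For a finite set $I$ with $|I|\ge 3$, let $\overline{M}_{0,I}$ be the moduli space, over $k$, of stable rational curves with marked points indexed by $I$; for $J\subset I$ with $|J|\ge 3$ let $\pi_J:\overline{M}_{0,I}\to\overline{M}_{0,J}$ be the forgetful morphism, which drops the marked points in $I\setminus J$ and stabilizes. Let $n\ge 2$, $N=\{1,\ldots,n\}$, and let $\Gamma=\{\Gamma_1,\ldots,\Gamma_d\}$ be a finite family of subsets of $N$ with $|\Gamma_j|\ge 3$ for every $j$. Consider the hypergraph morphism $$\pi_{\Gamma\cup\{n+1\}}=\prod_{j=1}^d \pi_{\Gamma_j\cup\{n+1\}}:\ \overline{M}_{0,n+1}\longrightarrow \prod_{j=1}^d\overline{M}_{0,\Gamma_j\cup\{n+1\}}$$ (the product is taken over $k$). Then: 1. $\pi_{\Gamma\cup\{n+1\}}$ is dominant if and only if $$\Bigl|\bigcup_{j\in S}\Gamma_j\Bigr|-2\ \ge\ \sum_{j\in S}\bigl(|\Gamma_j|-2\bigr)\qquad\text{for every non-empty subset } S\subset\{1,\ldots,d\}.$$ 2. $\pi_{\Gamma\cup\{n+1\}}$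 is birational if and only if it is dominant and $n-2=\sum_{j=1}^d\bigl(|\Gamma_j|-2\bigr)$. -/

import Mathlib

open CategoryTheory CategoryTheory.Limits AlgebraicGeometry

universe u

noncomputable section

namespace HypergraphMorphism

/-! ### The projective line -/

section ProjectiveLine

attribute [local instance] MvPolynomial.gradedAlgebra

/-- The projective line `ℙ¹ = Proj k[X₀, X₁]` over `k`, as a scheme over `Spec k`. -/
def P1 (k : Type u) [Field k] : Over (Spec (.of k)) :=
  Over.mk (Proj.toSpecZero (MvPolynomial.homogeneousSubmodule (Fin 2) k) ≫
    Spec.map (CommRingCat.ofHom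
      (algebraMap k (MvPolynomial.homogeneousSubmodule (Fin 2) k 0))))

variable {k : Type u} [Field k] {R : Type u} [CommRing R] [Algebra k R]

/-- For a unit `b`, the evaluation of degree zero fractions in `k[X₀, X₁]` with denominator a power
of `X₁` at `X₀ = a`, `X₁ = b`. -/
def evalAway (a b : R) (hb : IsUnit b) :
    HomogeneousLocalization.Away (MvPolynomial.homogeneousSubmodule (Fin 2) k)
      (MvPolynomial.X 1 : MvPolynomial (Fin 2) k) →+* R :=
  (IsLocalization.Away.lift (S := Localization.Away (MvPolynomial.X 1 : MvPolynomial (Fin 2) k))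
      (MvPolynomial.X 1 : MvPolynomial (Fin 2) k)
      (g := (MvPolynomial.aeval ![a, b] : MvPolynomial (Fin 2) k →ₐ[k] R).toRingHom)
      (by simpa using hb)).comp
    (algebraMap (HomogeneousLocalization.Away (MvPolynomial.homogeneousSubmodule (Fin 2) k)
      (MvPolynomial.X 1 : MvPolynomial (Fin 2) k))
      (Localization.Away (MvPolynomial.X 1 : MvPolynomial (Fin 2) k)))

/-- The morphism `[a : b] : Spec R ⟶ ℙ¹` for `a, b ∈ R` with `b` a unit. It lands in the standard
chart `X₁ ≠ 0`. -/
def ratioHom (a b : R) (hb : IsUnit b) :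
    Spec (.of R) ⟶ Proj (MvPolynomial.homogeneousSubmodule (Fin 2) k) :=
  Spec.map (CommRingCat.ofHom (evalAway (k := k) a b hb)) ≫
    Proj.awayι _ (MvPolynomial.X 1 : MvPolynomial (Fin 2) k)
      ((MvPolynomial.mem_homogeneousSubmodule 1 _).mpr (MvPolynomial.isHomogeneous_X k 1)) one_pos

lemma evalAway_comp_fromZeroRingHom (a b : R) (hb : IsUnit b) :
    ((evalAway (k := k) a b hb).comp (HomogeneousLocalization.fromZeroRingHom
      (MvPolynomial.homogeneousSubmodule (Fin 2) k) _)).comp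
      (algebraMap k (MvPolynomial.homogeneousSubmodule (Fin 2) k 0)) = algebraMap k R := by
  ext c
  have h : algebraMap (HomogeneousLocalization.Away (MvPolynomial.homogeneousSubmodule (Fin 2) k)
        (MvPolynomial.X 1 : MvPolynomial (Fin 2) k))
        (Localization.Away (MvPolynomial.X 1 : MvPolynomial (Fin 2) k))
        (HomogeneousLocalization.fromZeroRingHom (MvPolynomial.homogeneousSubmodule (Fin 2) k) _
          (algebraMap k (MvPolynomial.homogeneousSubmodule (Fin 2) k 0) c)) =
      algebraMap (MvPolynomial (Fin 2) k) _ (MvPolynomial.C c) := by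
    rfl
  simp only [evalAway, RingHom.comp_apply, h, IsLocalization.Away.lift_eq]
  simp

lemma map_evalAway {R' : Type u} [CommRing R'] [Algebra k R'] (φ : R →ₐ[k] R') (a b : R)
    (hb : IsUnit b) :
    φ.toRingHom.comp (evalAway (k := k) a b hb) = evalAway (φ a) (φ b) (hb.map φ) := by
  rw [evalAway, evalAway, ← RingHom.comp_assoc]
  congr 1
  apply IsLocalization.ringHom_ext (Submonoid.powers (MvPolynomial.X 1 : MvPolynomial (Fin 2) k))
  rw [RingHom.comp_assoc, IsLocalization.Away.lift_comp, IsLocalization.Away.lift_comp]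
  ext i
  · simp
  · fin_cases i <;> simp

/-- The morphism `[a : b] : Spec R ⟶ ℙ¹` as a morphism over `Spec k`. -/
def ratio (a b : R) (hb : IsUnit b) :
    Over.mk (Spec.map (CommRingCat.ofHom (algebraMap k R))) ⟶ P1 k :=
  Over.homMk (ratioHom a b hb) (by
    dsimp [P1, ratioHom]
    rw [Category.assoc, Proj.awayι_toSpecZero_assoc, ← Spec.map_comp, ← Spec.map_comp,
      ← CommRingCat.ofHom_comp, ← CommRingCat.ofHom_comp, ← evalAway_comp_fromZeroRingHom a b hb,
      RingHom.comp_assoc])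

lemma map_ratio {R' : Type u} [CommRing R'] [Algebra k R'] (φ : R →ₐ[k] R') (a b : R)
    (hb : IsUnit b) (h : _) :
    (Over.homMk (Spec.map (CommRingCat.ofHom φ.toRingHom)) h :
      Over.mk (Spec.map (CommRingCat.ofHom (algebraMap k R'))) ⟶
        Over.mk (Spec.map (CommRingCat.ofHom (algebraMap k R)))) ≫ ratio a b hb =
      ratio (φ a) (φ b) (hb.map φ) := by
  ext1
  change Spec.map (CommRingCat.ofHom φ.toRingHom) ≫ ratioHom a b hb = ratioHom (φ a) (φ b) _
  simp only [ratioHom, ← map_evalAway φ a b hb,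
    CommRingCat.ofHom_comp, Spec.map_comp, Category.assoc]

end ProjectiveLine

/-! ### Configurations of distinct points on the projective line -/

section Configurations

variable (k : Type u) [Field k] (I : Type)

/-- The bracket `[a b] = x_a y_b - y_a x_b`, which vanishes exactly when the points
`(x_a : y_a)` and `(x_b : y_b)` coincide. Here `x_a = X (a, 0)` and `y_a = X (a, 1)`. -/
def bracket (a b : I) : MvPolynomial (I × Fin 2) k :=
  .X (a, 0) * .X (b, 1) - .X (a, 1) * .X (b, 0)

lemma rename_bracket {J : Type} (e : J → I) (a b : J) :
    MvPolynomial.rename (Prod.map e id) (bracket k J a b) = bracket k I (e a) (e b) := by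
  simp [bracket]

variable [Fintype I]

/-- The product of the brackets of all pairs of distinct indices. -/
def discriminant : MvPolynomial (I × Fin 2) k :=
  ∏ p ∈ (Finset.univ : Finset I).offDiag, bracket k I p.1 p.2

/-- The coordinate ring of the variety of families `(x_a, y_a)`, `a ∈ I`, of homogeneous
coordinates of pairwise distinct points of the projective line. -/
abbrev ConfRing : Type u := Localization.Away (discriminant k I)

/-- The variety of families of homogeneous coordinates of pairwise distinct points of `ℙ¹`
indexed by `I`. For `|I| ≥ 3`, the moduli space `M_{0,I}` is its quotient by the changes of coordinates on `ℙ¹`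
and by the rescalings of the homogeneous coordinates of each point. -/
def Conf : Over (Spec (.of k)) :=
  Over.mk (Spec.map (CommRingCat.ofHom (algebraMap k (ConfRing k I))))

/-- The bracket as a regular function on the configuration variety. -/
def br (a b : I) : ConfRing k I := algebraMap _ _ (bracket k I a b)

variable {I}

lemma isUnit_br {a b : I} (h : a ≠ b) : IsUnit (br k I a b) := by
  refine isUnit_of_dvd_unit (map_dvd _ ?_)
    (IsLocalization.Away.algebraMap_isUnit (S := ConfRing k I) (discriminant k I))
  exact Finset.dvd_prod_of_mem (fun p : I × I ↦ bracket k I p.1 p.2)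
    (a := (a, b)) (by simpa using h)

/-- The cross-ratio `[ac][bd] : [ad][bc]` of the four distinct points with indices
`(a, b, c, d) = (t 0, t 1, t 2, t 3)`, as a morphism to the projective line. -/
def crossRatio (t : Fin 4 ↪ I) : Conf k I ⟶ P1 k :=
  ratio (br k I (t 0) (t 2) * br k I (t 1) (t 3)) (br k I (t 0) (t 3) * br k I (t 1) (t 2))
    ((isUnit_br k (by simp)).mul (isUnit_br k (by simp)))

variable (I)

/-- The product of copies of the projective line indexed by ordered quadruples of distinct
elements of `I`. -/
def QuadProd : Over (Spec (.of k)) := ∏ᶜ fun _ : Fin 4 ↪ I ↦ P1 k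

/-- The map recording all cross-ratios of a configuration. Two configurations over a field have the
same cross-ratios if and only if they are projectively equivalent, so its image is `M_{0,I}`. -/
def crossRatios : Conf k I ⟶ QuadProd k I := Pi.lift fun t ↦ crossRatio k t

/-- The Grothendieck-Knudsen space `M̄_{0,I}` of stable rational curves with marked points indexed
by `I`, in its cross-ratio embedding: the Zariski closure of `M_{0,I}` in the product of projective
lines given by the cross-ratios of all quadruples of marked points
(Gerritzen-Herrlich-van der Put, Keel). -/
def MBar : Over (Spec (.of k)) :=
  Over.mk ((crossRatios k I).left.imageι ≫ (QuadProd k I).hom)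

end Configurations

/-! ### Forgetful morphisms -/

section Forgetful

variable (k : Type u) [Field k] {I J : Type} [Fintype I] [Fintype J]
  (e : J ↪ I)

/-- Forgetting the cross-ratios that involve points outside `J`. -/
def quadProj : QuadProd k I ⟶ QuadProd k J :=
  Pi.lift fun t ↦ Pi.π (fun _ : Fin 4 ↪ I ↦ P1 k) (t.trans e)

lemma isUnit_rename_discriminant :
    IsUnit (algebraMap (MvPolynomial (I × Fin 2) k) (ConfRing k I)
      (MvPolynomial.rename (Prod.map e id) (discriminant k J))) := by
  have h : MvPolynomial.rename (Prod.map e id) (discriminant k J) =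
      ∏ p ∈ (Finset.univ : Finset J).offDiag, bracket k I (e p.1) (e p.2) := by
    simp only [discriminant, map_prod, rename_bracket]
  rw [h, map_prod]
  exact IsUnit.prod_iff.mpr fun p hp ↦
    isUnit_br k (e.injective.ne (Finset.mem_offDiag.mp hp).2.2)

/-- Pull-back of functions along the map of configurations that drops the points outside `J`. -/
def confRestrict : ConfRing k J →ₐ[k] ConfRing k I :=
  IsLocalization.liftAlgHom (M := Submonoid.powers (discriminant k J))
    (f := (IsScalarTower.toAlgHom k (MvPolynomial (I × Fin 2) k) (ConfRing k I)).comp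
      (MvPolynomial.rename (Prod.map e id))) (by
    rintro ⟨_, m, rfl⟩
    rw [map_pow]
    exact (isUnit_rename_discriminant k e).pow m)

lemma confRestrict_br (a b : J) : confRestrict k e (br k J a b) = br k I (e a) (e b) := by
  rw [confRestrict, br, IsLocalization.liftAlgHom_apply, IsLocalization.lift_eq]
  simp [rename_bracket, br]

/-- The map of configurations that drops the points outside `J`. -/
def confForget : Conf k I ⟶ Conf k J :=
  Over.homMk (Spec.map (CommRingCat.ofHom (confRestrict k e).toRingHom)) (by
    simp [Conf, ← Spec.map_comp, ← CommRingCat.ofHom_comp])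

lemma confForget_crossRatios :
    confForget k e ≫ crossRatios k J = crossRatios k I ≫ quadProj k e := by
  refine Pi.hom_ext _ _ fun t ↦ ?_
  have h₁ (K : Type) [Fintype K] (t : Fin 4 ↪ K) :
      crossRatios k K ≫ Pi.π (fun _ : Fin 4 ↪ K ↦ P1 k) t = crossRatio k t :=
    Pi.lift_π _ _
  have h₂ : quadProj k e ≫ Pi.π (fun _ : Fin 4 ↪ J ↦ P1 k) t =
      Pi.π (fun _ : Fin 4 ↪ I ↦ P1 k) (t.trans e) :=
    Pi.lift_π _ _
  refine (Category.assoc _ _ _).trans (Eq.trans ?_ (Category.assoc _ _ _).symm)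
  refine (congrArg (confForget k e ≫ ·) (h₁ J t)).trans (Eq.trans ?_
    ((congrArg (crossRatios k I ≫ ·) h₂).trans (h₁ I (t.trans e))).symm)
  refine (map_ratio (confRestrict k e) _ _ _ _).trans ?_
  simp [crossRatio, confRestrict_br]

/-- The forgetful morphism `M̄_{0,I} ⟶ M̄_{0,J}` that drops the marked points outside `J` and
stabilizes. It is the unique morphism extending the map `M_{0,I} ⟶ M_{0,J}` that drops these
points; it keeps the cross-ratios of the remaining points. -/
def forget : MBar k I ⟶ MBar k J :=
  Over.homMk
    (Scheme.IdealSheafData.subschemeMap (crossRatios k I).left.ker (crossRatios k J).left.ker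
      (quadProj k e).left (by
        rw [Scheme.IdealSheafData.map_ker, ← Over.comp_left, ← confForget_crossRatios,
          Over.comp_left]
        exact Scheme.Hom.le_ker_comp _ _))
    (by
      dsimp [MBar]
      rw [Scheme.IdealSheafData.subschemeMap_subschemeι_assoc, Over.w])

end Forgetful

/-! ### Hypergraph morphisms -/

/-- A morphism of schemes is birational if it restricts to an isomorphism from a dense open
subscheme of the source to a dense open subscheme of the target. -/
def IsBirational {X Y : Scheme.{u}} (f : X ⟶ Y) : Prop :=
  ∃ g : X.PartialIso Y, g.iso.hom ≫ g.target.ι = g.source.ι ≫ f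

/-- The hypergraph morphism: the product over the hyperedges `Γ j ⊆ N` of the forgetful morphisms
`M̄_{0,N} ⟶ M̄_{0,Γ j}`. -/
def hypergraphMorphism (k : Type u) [Field k] {N : Type} [Fintype N] {d : ℕ}
    (Γ : Fin d → Finset N) : MBar k N ⟶ ∏ᶜ fun j : Fin d ↦ MBar k (Γ j) :=
  Pi.lift fun j ↦ forget k (Function.Embedding.subtype (· ∈ Γ j))

/-- The cone `Γ ∪ {n+1}` over a hypergraph on `n` vertices. The vertices `1, …, n` are the
elements `i.castSucc` of `Fin (n + 1)`, and the new vertex is the last element. -/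
def cone {n d : ℕ} (Γ : Fin d → Finset (Fin n)) (j : Fin d) : Finset (Fin (n + 1)) :=
  insert (Fin.last n) ((Γ j).map Fin.castSuccEmb)

end HypergraphMorphism

end

universe w

noncomputable section

namespace HypergraphMorphism

/-! Put the point `n + 1`, common to all hyperedges of the cone, at infinity. A smooth curve is then
a family of `n` distinct points `x i` of the affine line up to affine maps. Once `a j ≠ b j` are
chosen in `Γ j`, the `j`-th forgetful map records the ratios `(x v - x (a j)) / (x (b j) - x (a j))`
for the other `|Γ j| - 2` vertices `v`. In dense open affine charts (`exists_dense_chart`,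
`exists_cone_chart`) the morphism is a homomorphism `φ` between localised polynomial rings that
sends the free coordinates to these ratios. It is dominant iff `φ` is injective
(`isDominant_iff_injective`), that is, iff the ratios are algebraically independent. It is
birational iff, in addition, `φ` is onto up to denominators (`IsBirational.exists_mul_eq`,
`isBirational_of_exists_mul_eq`).

Necessity of the inequalities: the ratios of the hyperedges in `S` lie in the field generated by the
positions of the points of their union, two of which can be moved to `0` and `1`
(`card_filter_add_two_le`).

Sufficiency: prescribe independent variables `U p` as ratios and regard `x v - x a = U p * (x b - x
a)` as a linear system in `x`. If no segment `a b` collapses on a solution space `W`, then `dim W +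
|P| ≤ |N|` (`finrank_add_card_le`): fix the free coordinates of `W` in `k`, and all `U p` become
rational functions of the `|N| - dim W` remaining ones. If some segments did collapse on all
solutions, identify the points that agree on all solutions and apply this bound to the quotient.
Comparison with `|N| ≤ dim W + |P|` contradicts the inequalities, summed over the classes
(`exists_nondegenerate_solution`). Treating every pair of points as one more segment gives distinct
points (`exists_injective_solution`), hence a specialisation at which the ratios are independent.

Birationality: surjectivity up to denominators forces `n - 2 ≤ ∑ (|Γ j| - 2)`, and dominance gives
the opposite inequality. Conversely, equality leaves the system only the two-dimensional space of
affine images of one solution. A linear system with a unique normalised solution is solved over the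
field of its coefficients (`mem_adjoin_range_of_card_le`), so the function fields agree in every
characteristic. -/

/-! ### Generic similarity systems -/

section SimilaritySystems

/-- Algebraically independent elements of a field generated by a finite family are at most as
numerous as the members of that family. -/
lemma card_le_of_algebraicIndependent_of_mem_adjoin {k F : Type*} [Field k] [Field F] [Algebra k F]
    {P : Type*} [Fintype P] {U : P → F} (hU : AlgebraicIndependent k U) (s : Set F) [Finite s]
    (h : ∀ p, U p ∈ IntermediateField.adjoin k s) : Fintype.card P ≤ s.ncard := by
  -- The comparison of transcendence degrees takes place in `E`, which is algebraic over the
  -- subalgebra generated by `s` because its elements are quotients of elements of that subalgebra.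
  let E := IntermediateField.adjoin k s
  let U' : P → E := fun p ↦ ⟨U p, h p⟩
  have hU' : AlgebraicIndependent k U' :=
    AlgebraicIndependent.of_comp E.val (by simpa [Function.comp_def, U'] using hU)
  let s' : Set E := E.val ⁻¹' s
  have halg : Algebra.IsAlgebraic (Algebra.adjoin k s') E := by
    constructor
    intro x
    have hx := x.2
    obtain ⟨r, hr, t, ht, hrt⟩ := IntermediateField.mem_adjoin_iff_div.mp hx
    have himg : Algebra.adjoin k s = (Algebra.adjoin k s').map E.val := by
      rw [AlgHom.map_adjoin]
      congr 1
      ext y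
      simp only [s', Set.mem_image, Set.mem_preimage]
      exact ⟨fun hy ↦ ⟨⟨y, IntermediateField.subset_adjoin k s hy⟩, hy, rfl⟩,
        by rintro ⟨z, hz, rfl⟩; exact hz⟩
    rw [himg] at hr ht
    obtain ⟨r', hr', rfl⟩ := hr
    obtain ⟨t', ht', rfl⟩ := ht
    have hxe : x = r' / t' := Subtype.ext hrt
    have h1 : IsAlgebraic (Algebra.adjoin k s') r' :=
      isAlgebraic_algebraMap (⟨r', hr'⟩ : Algebra.adjoin k s')
    have h2 : IsAlgebraic (Algebra.adjoin k s') t' :=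
      isAlgebraic_algebraMap (⟨t', ht'⟩ : Algebra.adjoin k s')
    rw [hxe, div_eq_mul_inv]
    exact h1.mul h2.inv
  have h1 := hU'.lift_cardinalMk_le_trdeg
  have h2 := Algebra.IsAlgebraic.trdeg_le_cardinalMk k s'
  have hfin : Finite s' := Set.Finite.preimage (E.val.injective.injOn) (Set.toFinite s)
  have h3 : s'.ncard ≤ s.ncard := by
    refine Set.ncard_le_ncard_of_injOn E.val (fun a ha ↦ ha) E.val.injective.injOn (Set.toFinite s)
  have h4 : Cardinal.lift.{_, _} (Cardinal.mk P) ≤ Cardinal.lift.{_, _} (Cardinal.mk s') :=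
    h1.trans (Cardinal.lift_le.mpr h2)
  rw [← Nat.cast_card, ← Nat.cast_card, Cardinal.lift_natCast, Cardinal.lift_natCast,
    Nat.cast_le] at h4
  rw [Nat.card_eq_fintype_card] at h4
  exact h4.trans h3

variable {F : Type*} [Field F] {N P D : Type*}

/-- The space of labellings `x : N → F` for which, for every `p`, the point `x (v p)` divides the
segment from `x (a (e p))` to `x (b (e p))` in the ratio prescribed by `U p`. -/
def solutionSpace (e : P → D) (v : P → N) (a b : D → N) (U : P → F) : Submodule F (N → F) where
  carrier := {x | ∀ p, x (v p) - x (a (e p)) = U p * (x (b (e p)) - x (a (e p)))}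
  zero_mem' := by simp
  add_mem' {x y} hx hy p := by
    have := hx p
    have := hy p
    simp only [Pi.add_apply]
    linear_combination hx p + hy p
  smul_mem' c x hx p := by
    simp only [Pi.smul_apply, smul_eq_mul]
    linear_combination c * hx p

lemma mem_solutionSpace {e : P → D} {v : P → N} {a b : D → N} {U : P → F} {x : N → F} :
    x ∈ solutionSpace e v a b U ↔
      ∀ p, x (v p) - x (a (e p)) = U p * (x (b (e p)) - x (a (e p))) := Iff.rfl

/-- A subspace of `F ^ N` projects isomorphically onto suitable coordinates. -/
lemma exists_coordinates {N : Type w} [Finite N] (W : Submodule F (N → F)) :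
    ∃ (κ : Type w) (c : κ → N), Function.Injective c ∧ Nat.card κ = Module.finrank F W ∧
      ∃ ψ : W ≃ₗ[F] (κ → F), ∀ w i, ψ w i = w.1 (c i) := by
  let f : N → Module.Dual F W := fun i ↦ (LinearMap.proj i).comp W.subtype
  -- A maximal independent family of coordinate functionals on `W` spans all of them, so it
  -- separates the vectors of `W`. Independence in the dual bounds its size by `finrank F W`.
  obtain ⟨κ, c, hc, hspan, hli⟩ := exists_linearIndependent' F f
  have : Finite κ := Finite.of_injective c hc
  let ψ : W →ₗ[F] (κ → F) := LinearMap.pi fun i ↦ f (c i)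
  have hinj : Function.Injective ψ := by
    rw [← LinearMap.ker_eq_bot, LinearMap.ker_eq_bot']
    intro w hw
    have hz : ∀ g ∈ Submodule.span F (Set.range f), g w = 0 := by
      rw [← hspan]
      intro g hg
      induction hg using Submodule.span_induction with
      | mem g hg =>
        obtain ⟨i, rfl⟩ := hg
        exact congrFun hw i
      | zero => rfl
      | add g h _ _ hg hh => simp [hg, hh]
      | smul t g _ hg => simp [hg]
    ext i
    exact hz (f i) (Submodule.subset_span ⟨i, rfl⟩)
  cases nonempty_fintype κ
  have hle : Fintype.card κ ≤ Module.finrank F W := by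
    rw [← Subspace.dual_finrank_eq]
    exact hli.fintype_card_le_finrank
  have hge : Module.finrank F W ≤ Fintype.card κ := by
    simpa using LinearMap.finrank_le_finrank_of_injective hinj
  refine ⟨κ, c, hc, by rw [Nat.card_eq_fintype_card]; omega,
    LinearEquiv.ofBijective ψ ⟨hinj, ?_⟩, fun w i ↦ rfl⟩
  rw [← LinearMap.range_eq_top]
  apply Submodule.eq_top_of_finrank_eq
  rw [LinearMap.finrank_range_of_inj hinj, Module.finrank_fintype_fun_eq_card]
  omega

/-- If the ratios `U` are algebraically independent and some solutions are non-degenerate, then the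
equations impose independent conditions on every space of solutions. -/
lemma finrank_add_card_le {k : Type*} [Field k] [Infinite k] [Algebra k F] [Finite D] [Fintype N]
    [Fintype P] {e : P → D} {v : P → N} {a b : D → N} {U : P → F} (hU : AlgebraicIndependent k U)
    (W : Submodule F (N → F)) (hW : W ≤ solutionSpace e v a b U)
    (hne : ∀ j, ∃ x ∈ W, x (a j) ≠ x (b j)) :
    Module.finrank F W + Fintype.card P ≤ Fintype.card N := by
  classical
  -- The free coordinates of `W` will be specialised to constants from `k`, so that they contribute
  -- nothing to the field generated by a solution.
  obtain ⟨κ, c, hc, hcard, ψ, hψ⟩ := exists_coordinates W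
  have : Finite κ := Finite.of_injective c hc
  cases nonempty_fintype κ
  let ι : (κ → k) →ₗ[k] (κ → F) := LinearMap.pi fun i ↦
    (Algebra.linearMap k F).comp (LinearMap.proj i)
  let pr (i : N) : (N → F) →ₗ[F] F := LinearMap.proj i
  let g (j : D) : (κ → F) →ₗ[F] F :=
    ((pr (b j) - pr (a j)).comp W.subtype).comp ψ.symm.toLinearMap
  have hg (j : D) : ((g j).restrictScalars k).comp ι ≠ 0 := by
    intro h0
    obtain ⟨x, hx, hxab⟩ := hne j
    -- An `F`-linear functional that vanishes on `k`-rational vectors vanishes on the standard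
    -- basis, hence everywhere.
    have hg0 : g j = 0 := by
      refine LinearMap.pi_ext' fun i ↦ LinearMap.ext_ring ?_
      have h1 := LinearMap.congr_fun h0 (Pi.single i 1)
      have h2 : ι (Pi.single i 1) = Pi.single i 1 := by
        ext i'
        by_cases h : i' = i
        · subst h; simp [ι]
        · simp [ι, h]
      simpa [h2] using h1
    have h3 := LinearMap.congr_fun hg0 (ψ ⟨x, hx⟩)
    simp only [pr, LinearMap.coe_comp, LinearEquiv.coe_coe, Function.comp_apply, g,
      LinearEquiv.symm_apply_apply, Submodule.subtype_apply, LinearMap.sub_apply,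
      LinearMap.proj_apply, LinearMap.zero_apply, sub_eq_zero] at h3
    exact hxab h3.symm
  -- Since `k` is infinite, `κ → k` is not a finite union of proper subspaces, so one constant
  -- vector keeps all segments non-degenerate.
  obtain ⟨y, hy⟩ : ∃ y : κ → k, ∀ j, g j (ι y) ≠ 0 := by
    by_contra! hcon
    have hcov : ⋃ j, (LinearMap.ker (((g j).restrictScalars k).comp ι) : Set (κ → k)) =
        Set.univ := by
      ext y
      obtain ⟨j, hj⟩ := hcon y
      simp only [Set.mem_iUnion, SetLike.mem_coe, LinearMap.mem_ker, Set.mem_univ, iff_true]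
      exact ⟨j, hj⟩
    obtain ⟨j, hj⟩ := Subspace.exists_eq_top_of_iUnion_eq_univ hcov
    exact hg j (LinearMap.ker_eq_top.mp hj)
  let x : N → F := (ψ.symm (ι y)).1
  have hxW : x ∈ W := (ψ.symm (ι y)).2
  have hxc (i : κ) : x (c i) = algebraMap k F (y i) := by
    rw [show x (c i) = ψ (ψ.symm (ι y)) i from (hψ _ _).symm, LinearEquiv.apply_symm_apply]
    rfl
  have hxab (j : D) : x (b j) - x (a j) ≠ 0 := hy j
  -- Only the dependent coordinates can be transcendental over `k`. There are `|N| - finrank F W` of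
  -- them, and they generate a field containing all the ratios.
  let s : Set F := x '' (Set.range c)ᶜ
  have hs : s.ncard + Module.finrank F W ≤ Fintype.card N := by
    have h1 : s.ncard ≤ (Set.range c)ᶜ.ncard := Set.ncard_image_le
    have h2 := Set.ncard_add_ncard_compl (Set.range c)
    rw [Set.ncard_range_of_injective hc, hcard, Nat.card_eq_fintype_card] at h2
    omega
  have hmem (i : N) : x i ∈ IntermediateField.adjoin k s := by
    by_cases hi : i ∈ Set.range c
    · obtain ⟨i, rfl⟩ := hi
      rw [hxc]
      exact IntermediateField.algebraMap_mem _ _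
    · exact IntermediateField.subset_adjoin _ _ ⟨i, hi, rfl⟩
  have hle : Fintype.card P ≤ s.ncard := by
    refine card_le_of_algebraicIndependent_of_mem_adjoin hU s fun p ↦ ?_
    have hp := mem_solutionSpace.mp (hW hxW) p
    rw [eq_comm, ← eq_div_iff (hxab _)] at hp
    rw [hp]
    exact div_mem (sub_mem (hmem _) (hmem _)) (sub_mem (hmem _) (hmem _))
  omega

end SimilaritySystems

/-! ### Existence of non-degenerate solutions -/

section SimilaritySystems

variable {F : Type*} [Field F] {N P D : Type*}

/-- Rank-nullity for `|P|` linear equations in `|N|` unknowns. It holds for arbitrary ratios and is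
played against the opposite bound `finrank_add_card_le` on the quotient. -/
lemma card_le_finrank_solutionSpace_add [Fintype N] [Fintype P] (e : P → D) (v : P → N)
    (a b : D → N) (U : P → F) :
    Fintype.card N ≤ Module.finrank F (solutionSpace e v a b U) + Fintype.card P := by
  let pr (i : N) : (N → F) →ₗ[F] F := LinearMap.proj i
  let g : (N → F) →ₗ[F] (P → F) := LinearMap.pi fun p ↦
    (pr (v p) - pr (a (e p))) - U p • (pr (b (e p)) - pr (a (e p)))
  have hg : LinearMap.ker g = solutionSpace e v a b U := by
    ext x
    rw [mem_solutionSpace, LinearMap.mem_ker, funext_iff]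
    refine forall_congr' fun p ↦ ?_
    simp [g, pr, sub_eq_zero]
  have h1 := LinearMap.finrank_range_add_finrank_ker g
  have h2 := (LinearMap.range g).finrank_le
  rw [hg] at h1
  simp only [Module.finrank_fintype_fun_eq_card] at h1 h2
  omega

/-- Rado-type criterion: if every set of segments, together with the points dividing them, involves
at least two more points than there are prescribed generic ratios, then the system has a solution
in which no segment is degenerate. -/
theorem exists_nondegenerate_solution {k : Type*} [Field k] [Infinite k] [Algebra k F] [Finite D]
    [Finite N] [Fintype P] [DecidableEq N] [DecidableEq D] {e : P → D} {v : P → N} {a b : D → N}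
    {U : P → F} (hU : AlgebraicIndependent k U)
    (hHall : ∀ S : Finset D, S.Nonempty → (Finset.univ.filter (e · ∈ S)).card + 2 ≤
      (S.biUnion fun j ↦ {a j, b j} ∪ (Finset.univ.filter (e · = j)).image v).card) :
    ∃ x ∈ solutionSpace e v a b U, ∀ j, x (a j) ≠ x (b j) := by
  classical
  cases nonempty_fintype N
  cases nonempty_fintype D
  have : Infinite F := Infinite.of_injective _ (algebraMap k F).injective
  set W := solutionSpace e v a b U with hW
  let pr (i : N) : (N → F) →ₗ[F] F := LinearMap.proj i
  -- Over the infinite field `F`, finitely many functionals, none of them zero on `W`, are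
  -- simultaneously non-zero at some vector. Segments can thus be treated one at a time.
  suffices h : ∀ j, ∃ x ∈ W, (pr (a j) - pr (b j)) x ≠ 0 by
    obtain ⟨x, hx, hx'⟩ := Module.Dual.exists_forall_mem_ne_zero_of_forall_exists W
      (fun j ↦ pr (a j) - pr (b j)) h
    exact ⟨x, hx, fun j ↦ sub_ne_zero.mp (hx' j)⟩
  by_contra! hcon
  obtain ⟨j₀, hj₀⟩ := hcon
  let S : Finset D := Finset.univ.filter fun j ↦ ∀ x ∈ W, x (a j) = x (b j)
  have hS {j : D} : j ∈ S ↔ ∀ x ∈ W, x (a j) = x (b j) := by simp [S]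
  have hj₀S : j₀ ∈ S := hS.mpr fun x hx ↦ sub_eq_zero.mp (hj₀ x hx)
  -- Points are identified when all solutions give them the same position. A segment in `S` falls
  -- into a single class together with the points that divide it.
  let r : Setoid N :=
    { r := fun i i' ↦ ∀ x ∈ W, x i = x i'
      iseqv := ⟨fun _ _ _ ↦ rfl, fun h x hx ↦ (h x hx).symm,
        fun h h' x hx ↦ (h x hx).trans (h' x hx)⟩ }
  let N' := Quotient r
  let q : N → N' := Quotient.mk r
  have hq {i i' : N} : q i = q i' ↔ ∀ x ∈ W, x i = x i' := Quotient.eq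
  have hqsurj : Function.Surjective q := Quotient.mk_surjective
  have hcollapse {p : P} (hp : e p ∈ S) : q (v p) = q (a (e p)) := hq.mpr fun x hx ↦ by
    have h1 := mem_solutionSpace.mp hx p
    rw [hS.mp hp x hx, sub_self, mul_zero, sub_eq_zero] at h1
    rw [h1, hS.mp hp x hx]
  have hcollapse' {j : D} (hj : j ∈ S) : q (b j) = q (a j) :=
    hq.mpr fun x hx ↦ (hS.mp hj x hx).symm
  -- the non-degenerate part of the system, on the quotient
  let T := LinearMap.funLeft F F q
  have hWT : W ≤ LinearMap.range T := fun x hx ↦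
    ⟨Quotient.lift x fun i i' h ↦ h x hx, rfl⟩
  let P' := {p : P // e p ∉ S}
  let D' := {j : D // j ∉ S}
  -- Every solution factors through the quotient, and there only the equations of the segments
  -- outside `S` are retained. None of these segments collapses on all of `W`, so the bound reads
  -- `finrank W + |P'| ≤ |N'|`.
  have h1 := finrank_add_card_le (e := fun p : P' ↦ (⟨e p, p.2⟩ : D')) (v := fun p ↦ q (v p))
    (a := fun j : D' ↦ q (a j)) (b := fun j : D' ↦ q (b j))
    (hU.comp (Subtype.val : P' → P) Subtype.val_injective) (W.comap T)
    (fun x hx p ↦ mem_solutionSpace.mp (Submodule.mem_comap.mp hx) p) (by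
      rintro ⟨j, hj⟩
      rw [hS] at hj
      push Not at hj
      obtain ⟨x, hx, hxab⟩ := hj
      obtain ⟨x', rfl⟩ := hWT hx
      exact ⟨x', hx, hxab⟩)
  have h2 : Module.finrank F W ≤ Module.finrank F (W.comap T) := by
    conv_lhs => rw [← Submodule.map_comap_eq_of_le hWT]
    exact Submodule.finrank_map_le T _
  have h3 : Fintype.card N ≤ Module.finrank F W + Fintype.card P :=
    card_le_finrank_solutionSpace_add e v a b U
  have h4 : Fintype.card P' + (Finset.univ.filter (e · ∈ S)).card = Fintype.card P := by
    rw [Fintype.card_subtype, add_comm, Finset.card_filter_add_card_filter_not, Finset.card_univ]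
  -- counting in the classes
  let PC (C : N') : Finset P := (Finset.univ.filter (e · ∈ S)).filter fun p ↦ q (a (e p)) = C
  let NC (C : N') : Finset N := Finset.univ.filter fun i ↦ q i = C
  have hP : (Finset.univ.filter (e · ∈ S)).card = ∑ C, (PC C).card :=
    Finset.card_eq_sum_card_fiberwise fun _ _ ↦ Finset.mem_coe.mpr (Finset.mem_univ _)
  have hN : Fintype.card N = ∑ C, (NC C).card :=
    Finset.card_eq_sum_card_fiberwise fun _ _ ↦ Finset.mem_coe.mpr (Finset.mem_univ _)
  -- The summand `2` of the Hall condition exceeds by one the single dimension that a class keeps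
  -- after collapsing. This surplus produces the contradiction.
  have hstrict (C : N') {j : D} (hj : j ∈ S) (hjC : q (a j) = C) :
      (PC C).card + 1 < (NC C).card := by
    let SC := S.filter fun j ↦ q (a j) = C
    have h5 := hHall SC ⟨j, by simp [SC, hj, hjC]⟩
    have h6 : PC C = Finset.univ.filter (e · ∈ SC) := by
      ext p
      simp [PC, SC]
    have h7 : (SC.biUnion fun j ↦ {a j, b j} ∪ (Finset.univ.filter (e · = j)).image v) ⊆ NC C := by
      intro i hi
      simp only [Finset.mem_biUnion, SC, Finset.mem_filter, Finset.mem_union, Finset.mem_insert,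
        Finset.mem_singleton, Finset.mem_image, Finset.mem_univ, true_and] at hi
      simp only [NC, Finset.mem_filter, Finset.mem_univ, true_and]
      obtain ⟨j, ⟨hj, hjC⟩, (rfl | rfl) | ⟨p, rfl, rfl⟩⟩ := hi
      · exact hjC
      · rw [hcollapse' hj, hjC]
      · rw [hcollapse hj, hjC]
    have h8 := Finset.card_le_card h7
    rw [h6]
    omega
  have hle (C : N') : (PC C).card + 1 ≤ (NC C).card := by
    by_cases h : ∃ j ∈ S, q (a j) = C
    · obtain ⟨j, hj, hjC⟩ := h
      exact (hstrict C hj hjC).le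
    · have h5 : PC C = ∅ := by
        ext p
        simp only [PC, Finset.mem_filter, Finset.mem_univ, true_and, Finset.notMem_empty,
          iff_false]
        exact fun hp ↦ h ⟨_, hp⟩
      obtain ⟨i, hi⟩ := hqsurj C
      rw [h5, Finset.card_empty, zero_add, Nat.succ_le_iff, Finset.card_pos]
      exact ⟨i, by simp [NC, hi]⟩
  -- Summation over classes gives `|P| - |P'| + |N'| < |N|`, whereas the two dimension bounds give
  -- `|N| ≤ |N'| - |P'| + |P|`.
  have h9 : ∑ C, ((PC C).card + 1) < ∑ C, (NC C).card :=
    Finset.sum_lt_sum (fun C _ ↦ hle C) ⟨q (a j₀), Finset.mem_univ _, hstrict _ hj₀S rfl⟩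
  rw [Finset.sum_add_distrib, ← hN, ← hP, Finset.sum_const, smul_eq_mul, mul_one,
    Finset.card_univ] at h9
  omega

end SimilaritySystems

/-! ### Affine schemes over a field -/

section AffineOver

variable {k : Type u} [Field k]

/-- The spectrum of a `k`-algebra as a scheme over `Spec k`. -/
abbrev specOver (k : Type u) [Field k] (R : Type u) [CommRing R] [Algebra k R] :
    Over (Spec (.of k)) :=
  Over.mk (Spec.map (CommRingCat.ofHom (algebraMap k R)))

variable {R R' R'' : Type u} [CommRing R] [Algebra k R] [CommRing R'] [Algebra k R']
  [CommRing R''] [Algebra k R'']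

lemma specOverMap_w (φ : R →ₐ[k] R') :
    Spec.map (CommRingCat.ofHom φ.toRingHom) ≫ (specOver k R).hom = (specOver k R').hom := by
  simp [← Spec.map_comp, ← CommRingCat.ofHom_comp]

/-- The morphism of spectra over `Spec k` induced by a homomorphism of `k`-algebras. -/
def specOverMap (φ : R →ₐ[k] R') : specOver k R' ⟶ specOver k R :=
  Over.homMk (Spec.map (CommRingCat.ofHom φ.toRingHom)) (specOverMap_w φ)

@[simp]
lemma specOverMap_left (φ : R →ₐ[k] R') :
    (specOverMap φ).left = Spec.map (CommRingCat.ofHom φ.toRingHom) := rfl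

lemma specOverMap_comp (φ : R →ₐ[k] R') (ψ : R' →ₐ[k] R'') :
    specOverMap ψ ≫ specOverMap φ = specOverMap (ψ.comp φ) := by
  ext1
  simp only [Over.comp_left, specOverMap_left, ← Spec.map_comp, ← CommRingCat.ofHom_comp]
  rfl

lemma specOverMap_comp_assoc (φ : R →ₐ[k] R') (ψ : R' →ₐ[k] R'') {T : Over (Spec (.of k))}
    (g : specOver k R ⟶ T) :
    specOverMap ψ ≫ specOverMap φ ≫ g = specOverMap (ψ.comp φ) ≫ g := by
  rw [← Category.assoc, specOverMap_comp]

lemma specOverMap_id : specOverMap (AlgHom.id k R) = 𝟙 _ := by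
  ext1
  exact Spec.map_id _

lemma exists_eq_specOverMap (g : specOver k R' ⟶ specOver k R) :
    ∃ φ : R →ₐ[k] R', g = specOverMap φ := by
  obtain ⟨φ, hφ⟩ := Spec.map_surjective g.left
  have hw := Over.w g
  rw [← hφ] at hw
  simp only [Over.mk_hom, ← Spec.map_comp] at hw
  have hw' := Spec.map_injective hw
  refine ⟨{ φ.hom with commutes' := fun c ↦ ?_ }, ?_⟩
  · exact congrArg (fun f : CommRingCat.of k ⟶ CommRingCat.of R' ↦ f.hom c) hw'
  · ext1
    exact hφ.symm

lemma specOverMap_injective {φ ψ : R →ₐ[k] R'} (h : specOverMap φ = specOverMap ψ) : φ = ψ := by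
  have h1 := Spec.map_injective (congrArg CommaMorphism.left h)
  ext x
  exact congrArg (fun f : CommRingCat.of R ⟶ CommRingCat.of R' ↦ f.hom x) h1

/-- The `k`-algebra of global sections of a scheme over `Spec k`. -/
def Sections (T : Over (Spec (.of k))) : Type u := Γ(T.left, ⊤)

instance (T : Over (Spec (.of k))) : CommRing (Sections T) :=
  inferInstanceAs (CommRing Γ(T.left, ⊤))

instance (T : Over (Spec (.of k))) : Algebra k (Sections T) :=
  RingHom.toAlgebra ((Scheme.ΓSpecIso (.of k)).inv ≫ T.hom.appTop).hom

/-- The canonical morphism to the spectrum of the algebra of global sections. -/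
def toSpecSections (T : Over (Spec (.of k))) : T ⟶ specOver k (Sections T) :=
  Over.homMk T.left.toSpecΓ (by
    change T.left.toSpecΓ ≫ Spec.map ((Scheme.ΓSpecIso (.of k)).inv ≫ T.hom.appTop) = T.hom
    rw [Spec.map_comp, ← Scheme.toSpecΓ_naturality_assoc, toSpecΓ_SpecMap_ΓSpecIso_inv]
    exact Category.comp_id _)

lemma exists_eq_toSpecSections_comp {T : Over (Spec (.of k))} (g : T ⟶ specOver k R) :
    ∃ φ : R →ₐ[k] Sections T, g = toSpecSections T ≫ specOverMap φ := by
  let γ : CommRingCat.of R ⟶ Γ(T.left, ⊤) := (Scheme.ΓSpecIso (.of R)).inv ≫ g.left.appTop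
  have hg : g.left = T.left.toSpecΓ ≫ Spec.map γ := by
    rw [Spec.map_comp, ← Scheme.toSpecΓ_naturality_assoc]
    exact (Category.comp_id _).symm.trans
      (congrArg (g.left ≫ ·) (toSpecΓ_SpecMap_ΓSpecIso_inv (.of R)).symm)
  have hγ : CommRingCat.ofHom (algebraMap k R) ≫ γ =
      (Scheme.ΓSpecIso (.of k)).inv ≫ T.hom.appTop := by
    rw [← Over.w g, Scheme.Hom.comp_appTop, ← Category.assoc, ← Category.assoc]
    congr 1
    exact Scheme.ΓSpecIso_inv_naturality _
  refine ⟨{ γ.hom with commutes' := fun c ↦ ?_ }, ?_⟩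
  · exact congrArg (fun f : CommRingCat.of k ⟶ Γ(T.left, ⊤) ↦ f.hom c) hγ
  · ext1
    exact hg

lemma toSpecΓ_comp_specMap_injective {X : Scheme.{u}} {R : CommRingCat.{u}} {f g : R ⟶ Γ(X, ⊤)}
    (h : X.toSpecΓ ≫ Spec.map f = X.toSpecΓ ≫ Spec.map g) : f = g := by
  have h3 := congrArg Scheme.Hom.appTop h
  rw [Scheme.Hom.comp_appTop, Scheme.Hom.comp_appTop, Scheme.toSpecΓ_appTop] at h3
  have h4 := (Scheme.ΓSpecIso_naturality f).symm.trans (h3.trans (Scheme.ΓSpecIso_naturality g))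
  exact (cancel_epi _).mp h4

end AffineOver

/-! ### Morphisms to the standard chart of the projective line -/

section ProjectiveLineCharts

attribute [local instance] MvPolynomial.gradedAlgebra

variable {k : Type u} [Field k] {R : Type u} [CommRing R] [Algebra k R]

/-- The coordinate `X₀ / X₁` on the standard chart `X₁ ≠ 0` of the projective line. -/
def awayCoord (k : Type u) [Field k] :
    HomogeneousLocalization.Away (MvPolynomial.homogeneousSubmodule (Fin 2) k)
      (MvPolynomial.X 1 : MvPolynomial (Fin 2) k) :=
  HomogeneousLocalization.Away.mk _
    ((MvPolynomial.mem_homogeneousSubmodule 1 _).mpr (MvPolynomial.isHomogeneous_X k 1)) 1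
    (MvPolynomial.X 0)
    ((MvPolynomial.mem_homogeneousSubmodule _ _).mpr (MvPolynomial.isHomogeneous_X k 0))

-- The degree-zero fractions form the polynomial ring in `X₀ / X₁` over `k`: the degree-zero part of
-- `k[X₀, X₁]` consists of constants, and a monomial over the matching power of `X₁` is a power of
-- that coordinate.
omit [Algebra k R] in
lemma away_ringHom_ext {χ χ' : HomogeneousLocalization.Away
      (MvPolynomial.homogeneousSubmodule (Fin 2) k)
      (MvPolynomial.X 1 : MvPolynomial (Fin 2) k) →+* R}
    (h₀ : (χ.comp (HomogeneousLocalization.fromZeroRingHom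
        (MvPolynomial.homogeneousSubmodule (Fin 2) k) _)).comp
        (algebraMap k (MvPolynomial.homogeneousSubmodule (Fin 2) k 0)) =
      (χ'.comp (HomogeneousLocalization.fromZeroRingHom
        (MvPolynomial.homogeneousSubmodule (Fin 2) k) _)).comp
        (algebraMap k (MvPolynomial.homogeneousSubmodule (Fin 2) k 0)))
    (h₁ : χ (awayCoord k) = χ' (awayCoord k)) : χ = χ' := by
  have hX1 := (MvPolynomial.mem_homogeneousSubmodule 1 _).mpr (MvPolynomial.isHomogeneous_X k (1 : Fin 2))
  have hgen := HomogeneousLocalization.Away.adjoin_mk_prod_pow_eq_top hX1 (Fin 2)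
    (MvPolynomial.X : Fin 2 → MvPolynomial (Fin 2) k) (by
      rw [_root_.eq_top_iff]
      intro p _
      induction p using MvPolynomial.induction_on with
      | C c =>
        exact algebraMap_mem (Algebra.adjoin (MvPolynomial.homogeneousSubmodule (Fin 2) k 0) _)
          (algebraMap k (MvPolynomial.homogeneousSubmodule (Fin 2) k 0) c)
      | add p q hp hq => exact add_mem (hp trivial) (hq trivial)
      | mul_X p i hp => exact mul_mem (hp trivial) (Algebra.subset_adjoin ⟨i, rfl⟩)) (fun _ ↦ 1)
    (fun i ↦ (MvPolynomial.mem_homogeneousSubmodule 1 _).mpr (MvPolynomial.isHomogeneous_X k i))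
  ext x
  have hx : x ∈ (⊤ : Subalgebra (MvPolynomial.homogeneousSubmodule (Fin 2) k 0) _) := trivial
  rw [← hgen] at hx
  induction hx using Algebra.adjoin_induction with
  | mem x hx =>
    obtain ⟨n, ai, hai, -, rfl⟩ := hx
    have : HomogeneousLocalization.Away.mk (MvPolynomial.homogeneousSubmodule (Fin 2) k) hX1 n
        (∏ i, (MvPolynomial.X i : MvPolynomial (Fin 2) k) ^ ai i)
        (hai ▸ SetLike.prod_pow_mem_graded _ _ _ _ fun i _ ↦
          (MvPolynomial.mem_homogeneousSubmodule 1 _).mpr (MvPolynomial.isHomogeneous_X k i)) =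
        awayCoord k ^ ai 0 := by
      apply HomogeneousLocalization.val_injective
      simp only [HomogeneousLocalization.Away.val_mk, HomogeneousLocalization.val_pow, awayCoord,
        Localization.mk_pow, Localization.mk_eq_mk_iff, Localization.r_iff_exists]
      refine ⟨1, ?_⟩
      simp only [smul_eq_mul, mul_one, Fin.sum_univ_two] at hai
      simp [Fin.prod_univ_two, ← hai]
      ring
    rw [this, map_pow, map_pow, h₁]
  | algebraMap r =>
    obtain ⟨c, rfl⟩ : ∃ c, algebraMap k (MvPolynomial.homogeneousSubmodule (Fin 2) k 0) c = r := by
      obtain ⟨p, hp⟩ := r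
      have h := (MvPolynomial.mem_homogeneousSubmodule _ _).mp hp
      refine ⟨p.coeff 0, Subtype.ext ?_⟩
      exact (MvPolynomial.totalDegree_eq_zero_iff_eq_C.mp
        (Nat.le_zero.mp h.totalDegree_le)).symm
    exact RingHom.congr_fun h₀ c
  | add x y _ _ hx hy => rw [map_add, map_add, hx, hy]
  | mul x y _ _ hx hy => rw [map_mul, map_mul, hx, hy]

lemma evalAway_awayCoord (a b : R) (hb : IsUnit b) :
    evalAway (k := k) a b hb (awayCoord k) * b = a := by
  have h : algebraMap (HomogeneousLocalization.Away (MvPolynomial.homogeneousSubmodule (Fin 2) k)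
      (MvPolynomial.X 1 : MvPolynomial (Fin 2) k))
      (Localization.Away (MvPolynomial.X 1 : MvPolynomial (Fin 2) k)) (awayCoord k) *
      algebraMap (MvPolynomial (Fin 2) k) _ (MvPolynomial.X 1) =
      algebraMap (MvPolynomial (Fin 2) k) _ (MvPolynomial.X 0) := by
    rw [HomogeneousLocalization.algebraMap_apply, awayCoord, HomogeneousLocalization.Away.val_mk,
      ← Localization.mk_one_eq_algebraMap, ← Localization.mk_one_eq_algebraMap, Localization.mk_mul,
      Localization.mk_eq_mk_iff, Localization.r_iff_exists]
    exact ⟨1, by simp [mul_comm]⟩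
  have h2 := congrArg (IsLocalization.Away.lift
      (S := Localization.Away (MvPolynomial.X 1 : MvPolynomial (Fin 2) k))
      (MvPolynomial.X 1 : MvPolynomial (Fin 2) k)
      (g := (MvPolynomial.aeval ![a, b] : MvPolynomial (Fin 2) k →ₐ[k] R).toRingHom)
      (by simpa using hb)) h
  rw [map_mul, IsLocalization.Away.lift_eq, IsLocalization.Away.lift_eq] at h2
  have h3 : evalAway (k := k) a b hb (awayCoord k) * MvPolynomial.aeval ![a, b]
      (MvPolynomial.X 1 : MvPolynomial (Fin 2) k) = MvPolynomial.aeval ![a, b]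
      (MvPolynomial.X 0 : MvPolynomial (Fin 2) k) := h2
  simpa using h3

lemma evalAway_eq_iff (a b a' b' : R) (hb : IsUnit b) (hb' : IsUnit b') :
    evalAway (k := k) a b hb = evalAway a' b' hb' ↔ a * b' = a' * b := by
  have h1 := evalAway_awayCoord (k := k) a b hb
  have h2 := evalAway_awayCoord (k := k) a' b' hb'
  constructor
  · intro h
    rw [h] at h1
    linear_combination b * h2 - b' * h1
  · intro h
    refine away_ringHom_ext ?_ ?_
    · rw [evalAway_comp_fromZeroRingHom, evalAway_comp_fromZeroRingHom]
    · apply (hb.mul hb').mul_left_injective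
      linear_combination (exp := 1) b' * h1 - b * h2 + h

/-- The chart is a monomorphism, so equality of points of `ℙ¹` inside it is equality of coordinates.
Through this criterion, identities between morphisms to `MBar` become identities in rings. -/
lemma ratio_eq_iff (a b a' b' : R) (hb : IsUnit b) (hb' : IsUnit b') :
    ratio (k := k) a b hb = ratio a' b' hb' ↔ a * b' = a' * b := by
  rw [← evalAway_eq_iff (k := k) a b a' b' hb hb']
  constructor
  · intro h
    have h1 : ratioHom (k := k) a b hb = ratioHom a' b' hb' := congrArg CommaMorphism.left h
    have h2 := Spec.map_injective ((cancel_mono (Proj.awayι _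
      (MvPolynomial.X 1 : MvPolynomial (Fin 2) k)
      ((MvPolynomial.mem_homogeneousSubmodule 1 _).mpr (MvPolynomial.isHomogeneous_X k 1))
      one_pos)).mp h1)
    ext x
    exact congrArg (fun f : CommRingCat.of (HomogeneousLocalization.Away
      (MvPolynomial.homogeneousSubmodule (Fin 2) k)
      (MvPolynomial.X 1 : MvPolynomial (Fin 2) k)) ⟶ CommRingCat.of R ↦ f.hom x) h2
  · intro h
    ext1
    change ratioHom (k := k) a b hb = ratioHom a' b' hb'
    rw [ratioHom, ratioHom, h]

lemma specOverMap_ratio {R' : Type u} [CommRing R'] [Algebra k R'] (φ : R →ₐ[k] R') (a b : R)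
    (hb : IsUnit b) : specOverMap φ ≫ ratio a b hb = ratio (φ a) (φ b) (hb.map φ) :=
  map_ratio φ a b hb _

/-- The open chart `X₁ ≠ 0` of the projective line. -/
def chart (k : Type u) [Field k] : (P1 k).left.Opens :=
  Proj.basicOpen (MvPolynomial.homogeneousSubmodule (Fin 2) k) (MvPolynomial.X 1)

lemma ratio_mem_chart (a b : R) (hb : IsUnit b) (x) : (ratio (k := k) a b hb).left x ∈ chart k := by
  rw [chart, ← Proj.opensRange_awayι _ (MvPolynomial.X 1 : MvPolynomial (Fin 2) k)
      ((MvPolynomial.mem_homogeneousSubmodule 1 _).mpr (MvPolynomial.isHomogeneous_X k 1)) one_pos]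
  change ratioHom a b hb x ∈ _
  rw [ratioHom]
  exact ⟨_, rfl⟩

/-- A morphism to the chart `X₁ ≠ 0` is given by a global function. -/
lemma exists_eq_ratio {T : Over (Spec (.of k))} (g : T ⟶ P1 k) (hg : ∀ x, g.left x ∈ chart k) :
    ∃ f : Sections T, g = toSpecSections T ≫ ratio f 1 isUnit_one := by
  let ι := Proj.awayι _ (MvPolynomial.X 1 : MvPolynomial (Fin 2) k)
    ((MvPolynomial.mem_homogeneousSubmodule 1 _).mpr (MvPolynomial.isHomogeneous_X k 1)) one_pos
  have hrange : Set.range g.left ⊆ Set.range ι := by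
    rintro _ ⟨x, rfl⟩
    have := hg x
    rw [chart, ← Proj.opensRange_awayι _ (MvPolynomial.X 1 : MvPolynomial (Fin 2) k)
      ((MvPolynomial.mem_homogeneousSubmodule 1 _).mpr (MvPolynomial.isHomogeneous_X k 1))
      one_pos] at this
    exact this
  let g' := IsOpenImmersion.lift ι g.left hrange
  have hg' : g' ≫ ι = g.left := IsOpenImmersion.lift_fac _ _ _
  obtain ⟨χ, hχ⟩ : ∃ χ : HomogeneousLocalization.Away
      (MvPolynomial.homogeneousSubmodule (Fin 2) k)
      (MvPolynomial.X 1 : MvPolynomial (Fin 2) k) →+* Sections T,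
      g' = T.left.toSpecΓ ≫ Spec.map (CommRingCat.ofHom χ) := by
    refine ⟨((Scheme.ΓSpecIso _).inv ≫ g'.appTop).hom, ?_⟩
    change g' = T.left.toSpecΓ ≫ Spec.map ((Scheme.ΓSpecIso _).inv ≫ g'.appTop)
    rw [Spec.map_comp, ← Scheme.toSpecΓ_naturality_assoc, toSpecΓ_SpecMap_ΓSpecIso_inv,
      Category.comp_id]
  -- As `g` is a morphism over `Spec k`, the homomorphism `χ` is the identity on constants, so the
  -- image of the coordinate determines it.
  have key : χ = evalAway (k := k) (χ (awayCoord k)) 1 isUnit_one := by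
    refine away_ringHom_ext ?_ ?_
    · rw [evalAway_comp_fromZeroRingHom]
      have h1 : T.left.toSpecΓ ≫ Spec.map (CommRingCat.ofHom
          ((χ.comp (HomogeneousLocalization.fromZeroRingHom
            (MvPolynomial.homogeneousSubmodule (Fin 2) k) _)).comp
            (algebraMap k (MvPolynomial.homogeneousSubmodule (Fin 2) k 0)))) = T.hom := by
        rw [← Over.w g, ← hg', hχ]
        dsimp [P1, ι]
        rw [Category.assoc, Category.assoc, Proj.awayι_toSpecZero_assoc, ← Spec.map_comp,
          ← Spec.map_comp, ← CommRingCat.ofHom_comp]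
        rfl
      have h2 : T.left.toSpecΓ ≫ Spec.map (CommRingCat.ofHom (algebraMap k (Sections T))) =
        T.hom := Over.w (toSpecSections T)
      have h3 := toSpecΓ_comp_specMap_injective (h1.trans h2.symm)
      ext c
      exact congrArg (fun f : CommRingCat.of k ⟶ Γ(T.left, ⊤) ↦ f.hom c) h3
    · simpa using (evalAway_awayCoord (k := k) (χ (awayCoord k)) 1 isUnit_one).symm
  refine ⟨χ (awayCoord k), ?_⟩
  ext1
  change g.left = T.left.toSpecΓ ≫ ratioHom (k := k) (R := Sections T)
    (χ (awayCoord k)) 1 isUnit_one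
  rw [ratioHom, ← key]
  exact (hg'.symm.trans (congrArg (· ≫ ι) hχ)).trans (Category.assoc _ _ _)

end ProjectiveLineCharts

/-! ### Normalised coordinates -/

section NormalisedCoordinates

variable {k : Type u} [Field k] {I : Type} [Fintype I] [DecidableEq I]
  {R R' : Type u} [CommRing R] [Algebra k R] [CommRing R'] [Algebra k R']

omit [Fintype I] in
/-- Homogeneous coordinates of the configuration with the point `o` at infinity and the other
points at the positions `v i`. -/
def coords (o : I) (v : I → R) (x : I × Fin 2) : R :=
  if x.1 = o then ![1, 0] x.2 else ![v x.1, 1] x.2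

/-- The determinant of the coordinates of two points. -/
def coordBracket (o : I) (v : I → R) (i j : I) : R :=
  coords o v (i, 0) * coords o v (j, 1) - coords o v (i, 1) * coords o v (j, 0)

omit [Fintype I] in
lemma coordBracket_of_ne (o : I) (v : I → R) {i j : I} (hi : i ≠ o) (hj : j ≠ o) :
    coordBracket o v i j = v i - v j := by
  simp [coordBracket, coords, hi, hj]

omit [Fintype I] in
lemma coordBracket_left (o : I) (v : I → R) {j : I} (hj : j ≠ o) :
    coordBracket o v o j = 1 := by
  simp [coordBracket, coords, hj]

omit [Fintype I] in
lemma coordBracket_right (o : I) (v : I → R) {i : I} (hi : i ≠ o) :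
    coordBracket o v i o = -1 := by
  simp [coordBracket, coords, hi]

/-- The values of `v` away from `o` have invertible differences. -/
def Separated (o : I) (v : I → R) : Prop :=
  ∀ i j, i ≠ o → j ≠ o → i ≠ j → IsUnit (v i - v j)

omit [Fintype I] [DecidableEq I] in
lemma Separated.map {o : I} {v : I → R} (hv : Separated o v) (φ : R →ₐ[k] R') :
    Separated o (fun i ↦ φ (v i)) := fun i j hi hj hij ↦ by
  simpa using (hv i j hi hj hij).map φ

omit [Fintype I] in
lemma isUnit_coordBracket {o : I} {v : I → R} (hv : Separated o v) {i j : I} (hij : i ≠ j) :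
    IsUnit (coordBracket o v i j) := by
  by_cases hi : i = o
  · subst hi
    rw [coordBracket_left _ _ hij.symm]
    exact isUnit_one
  by_cases hj : j = o
  · subst hj
    rw [coordBracket_right _ _ hi]
    exact isUnit_one.neg
  rw [coordBracket_of_ne _ _ hi hj]
  exact hv i j hi hj hij

omit [DecidableEq I] in
lemma confRing_algHom_ext {φ ψ : ConfRing k I →ₐ[k] R}
    (h : ∀ x, φ (algebraMap (MvPolynomial (I × Fin 2) k) _ (MvPolynomial.X x)) =
      ψ (algebraMap (MvPolynomial (I × Fin 2) k) _ (MvPolynomial.X x))) :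
    φ = ψ := by
  have : φ.toRingHom = ψ.toRingHom := by
    apply IsLocalization.ringHom_ext (Submonoid.powers (discriminant k I))
    refine MvPolynomial.ringHom_ext (fun c ↦ ?_) h
    have h1 := φ.commutes c
    have h2 := ψ.commutes c
    rw [IsScalarTower.algebraMap_apply k (MvPolynomial (I × Fin 2) k) (ConfRing k I)] at h1 h2
    exact h1.trans h2.symm
  exact AlgHom.ext fun x ↦ RingHom.congr_fun this x

variable (k) in
lemma isUnit_aeval_discriminant {o : I} {v : I → R} (hv : Separated o v) :
    IsUnit (MvPolynomial.aeval (R := k) (coords o v) (discriminant k I)) := by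
  rw [discriminant, map_prod]
  refine IsUnit.prod_iff.mpr fun p hp ↦ ?_
  have := isUnit_coordBracket hv (Finset.mem_offDiag.mp hp).2.2
  simpa [bracket, coordBracket] using this

variable (k) in
/-- The configuration with the point `o` at infinity and the other points at the positions `v i`,
as a point of the configuration variety. -/
def stdHom (o : I) (v : I → R) (hv : Separated o v) : ConfRing k I →ₐ[k] R :=
  IsLocalization.liftAlgHom (M := Submonoid.powers (discriminant k I))
    (f := MvPolynomial.aeval (coords o v)) (by
      rintro ⟨_, m, rfl⟩
      rw [map_pow]
      exact (isUnit_aeval_discriminant k hv).pow m)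

lemma stdHom_X (o : I) (v : I → R) (hv : Separated o v) (x : I × Fin 2) :
    stdHom k o v hv (algebraMap (MvPolynomial (I × Fin 2) k) _ (MvPolynomial.X x)) = coords o v x := by
  rw [stdHom, IsLocalization.liftAlgHom_apply, IsLocalization.lift_eq]
  simp

lemma stdHom_br (o : I) (v : I → R) (hv : Separated o v) (i j : I) :
    stdHom k o v hv (br k I i j) = coordBracket o v i j := by
  simp only [br, bracket, map_sub, map_mul, stdHom_X, coordBracket]

lemma comp_stdHom (φ : R →ₐ[k] R') (o : I) (v : I → R) (hv : Separated o v) :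
    φ.comp (stdHom k o v hv) = stdHom k o (fun i ↦ φ (v i)) (hv.map φ) := by
  refine confRing_algHom_ext fun x ↦ ?_
  rw [AlgHom.comp_apply, stdHom_X, stdHom_X]
  obtain ⟨i, s⟩ := x
  simp only [coords]
  split_ifs <;> fin_cases s <;> simp

/-- The value at `o` is a dummy: that point has homogeneous coordinates `(1 : 0)`. -/
lemma stdHom_congr {o : I} {v w : I → R} (h : ∀ i, i ≠ o → v i = w i) (hv : Separated o v)
    (hw : Separated o w) : stdHom k o v hv = stdHom k o w hw := by
  refine confRing_algHom_ext fun x ↦ ?_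
  rw [stdHom_X, stdHom_X]
  simp only [coords]
  split_ifs with hx
  · rfl
  · rw [h _ hx]

/-! ### Cross-ratios -/

/-- The affine coordinate of the point `i` for which `o`, `a`, `b` are at `∞`, `0`, `1`. -/
def normCoord (k : Type u) [Field k] {I : Type} [Fintype I] (o a b i : I) : ConfRing k I :=
  br k I i a * br k I b o * Ring.inverse (br k I i o * br k I b a)

omit [DecidableEq I] in
lemma normCoord_mul {o a b i : I} (hi : i ≠ o) (hab : a ≠ b) :
    normCoord k o a b i * (br k I i o * br k I b a) = br k I i a * br k I b o := by
  rw [normCoord, mul_assoc, Ring.inverse_mul_cancel, mul_one]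
  exact (isUnit_br k hi).mul (isUnit_br k hab.symm)

omit [DecidableEq I] in
lemma br_self (i : I) : br k I i i = 0 := by
  simp [br, bracket, mul_comm]

omit [DecidableEq I] in
lemma br_swap (i j : I) : br k I i j = -br k I j i := by
  simp only [br, bracket, map_sub, map_mul]
  ring

omit [DecidableEq I] in
lemma br_plucker (i j a o : I) :
    br k I i a * br k I j o - br k I j a * br k I i o = br k I i j * br k I a o := by
  simp only [br, bracket, map_sub, map_mul]
  ring

-- The Plücker relation turns a difference of normalised coordinates into a product of brackets up
-- to invertible factors. Distinct points therefore have invertible differences.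
omit [DecidableEq I] in
lemma normCoord_sub {o a b i j : I} (hi : i ≠ o) (hj : j ≠ o) (hab : a ≠ b) :
    (normCoord k o a b i - normCoord k o a b j) * (br k I i o * br k I j o * br k I b a) =
      br k I i j * (br k I a o * br k I b o) := by
  have h1 := normCoord_mul (k := k) hi hab
  have h2 := normCoord_mul (k := k) hj hab
  have h3 := br_plucker (k := k) i j a o
  linear_combination br k I j o * h1 - br k I i o * h2 + br k I b o * h3

omit [DecidableEq I] in
lemma separated_normCoord {o a b : I} (hao : a ≠ o) (hbo : b ≠ o) (hab : a ≠ b) :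
    Separated o (normCoord k o a b) := fun i j hi hj hij ↦ by
  have h := normCoord_sub (k := k) hi hj hab
  have h2 : IsUnit (br k I i j * (br k I a o * br k I b o)) :=
    (isUnit_br k hij).mul ((isUnit_br k hao).mul (isUnit_br k hbo))
  rw [← h] at h2
  exact isUnit_of_mul_isUnit_left h2

omit [DecidableEq I] in
lemma normCoord_a {o a b : I} : normCoord k o a b a = 0 := by
  rw [normCoord, br_self, zero_mul, zero_mul]

omit [DecidableEq I] in
lemma normCoord_b {o a b : I} (hbo : b ≠ o) (hab : a ≠ b) :
    normCoord k o a b b = 1 := by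
  rw [normCoord, mul_comm (br k I b a), Ring.mul_inverse_cancel]
  exact (isUnit_br k hbo).mul (isUnit_br k hab.symm)

lemma stdHom_normCoord {o a b : I} (hao : a ≠ o) (hbo : b ≠ o) (hab : a ≠ b) {v : I → R}
    (hv : Separated o v) {i : I} (hi : i ≠ o) :
    stdHom k o v hv (normCoord k o a b i) * (v b - v a) = v i - v a := by
  have h := congrArg (stdHom k o v hv) (normCoord_mul (k := k) hi hab)
  have hia : coordBracket o v i a = v i - v a := coordBracket_of_ne o v hi hao
  simp only [map_mul, stdHom_br, coordBracket_right o v hi, coordBracket_right o v hbo,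
    coordBracket_of_ne o v hbo hao, hia] at h
  linear_combination -h

end NormalisedCoordinates

/-! ### Open subschemes over a base -/

section OpensOver

variable {S : Scheme.{u}}

/-- An open subscheme of a scheme over `S`, as a scheme over `S`. -/
def opensOver (X : Over S) (O : X.left.Opens) : Over S := Over.mk (O.ι ≫ X.hom)

/-- The inclusion of an open subscheme. -/
def opensOverι (X : Over S) (O : X.left.Opens) : opensOver X O ⟶ X := Over.homMk O.ι rfl

instance (X : Over S) (O : X.left.Opens) : Mono (opensOverι X O) :=
  have : Mono (opensOverι X O).left := inferInstanceAs (Mono O.ι)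
  Over.mono_of_mono_left _

instance (X : Over S) (O : X.left.Opens) : IsOpenImmersion (opensOverι X O).left := by
  have h : IsOpenImmersion (Scheme.Opens.ι (X := X.left) O) := inferInstance
  exact h

lemma opensOverι_mem (X : Over S) (O : X.left.Opens) (x) : (opensOverι X O).left x ∈ O :=
  x.2

lemma exists_opens_lift {X T : Scheme.{u}} {O : X.Opens} (g : T ⟶ X) (hg : ∀ x, g x ∈ O) :
    ∃ g' : T ⟶ O.toScheme, g' ≫ O.ι = g := by
  have hr : Set.range g ⊆ Set.range O.ι := by
    rintro _ ⟨x, rfl⟩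
    rw [Scheme.Opens.range_ι]
    exact hg x
  exact ⟨IsOpenImmersion.lift O.ι g hr, IsOpenImmersion.lift_fac _ _ _⟩

lemma eq_appTop_of_comp_toSpecΓ {T : Scheme.{u}} {R : CommRingCat.{u}} (g : Spec R ⟶ T)
    (ρ : Γ(T, ⊤) ⟶ R) (h : g ≫ T.toSpecΓ = Spec.map ρ) :
    ρ = g.appTop ≫ (Scheme.ΓSpecIso R).hom := by
  have h2 := congrArg Scheme.Hom.appTop h
  rw [Scheme.Hom.comp_appTop, Scheme.toSpecΓ_appTop] at h2
  rw [← cancel_epi (Scheme.ΓSpecIso _).hom, ← Scheme.ΓSpecIso_naturality, ← h2, Category.assoc]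

lemma appTop_injective_of_comp_ι {X T : Scheme.{u}} {O : X.Opens} (g : T ⟶ O.toScheme)
    (h : Function.Injective ((g ≫ O.ι).app (O.ι ''ᵁ ⊤))) : Function.Injective g.appTop := by
  -- The preimage of the image of `⊤` is equal to `⊤` but not definitionally, so the statement is
  -- first generalised to an open `V` equal to `⊤`.
  have h6 (V : O.toScheme.Opens) (hV : V = ⊤) (h : Function.Injective (g.app V)) :
      Function.Injective g.appTop := by
    subst hV
    exact h
  refine h6 (O.ι ⁻¹ᵁ (O.ι ''ᵁ ⊤)) (O.ι.preimage_image_eq ⊤) ?_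
  rw [Scheme.Hom.comp_app] at h
  have h8 : Function.Bijective (O.ι.app (O.ι ''ᵁ ⊤)) := ConcreteCategory.bijective_of_isIso _
  intro x y hxy
  obtain ⟨x, rfl⟩ := h8.2 x
  obtain ⟨y, rfl⟩ := h8.2 y
  exact congrArg _ (h hxy)

lemma exists_opensOver_lift {X T : Over S} {O : X.left.Opens} (g : T ⟶ X)
    (hg : ∀ x, g.left x ∈ O) : ∃ g' : T ⟶ opensOver X O, g' ≫ opensOverι X O = g := by
  obtain ⟨g', hg'⟩ := exists_opens_lift (X := X.left) (O := O) g.left hg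
  refine ⟨Over.homMk g' ?_, ?_⟩
  · change g' ≫ O.ι ≫ X.hom = _
    rw [reassoc_of% hg', Over.w]
  · ext1
    exact hg'

end OpensOver

/-! ### The space of stable curves -/

section StableCurves

variable (k : Type u) [Field k] (I : Type) [Fintype I]

instance : IsNoetherianRing (ConfRing k I) :=
  IsLocalization.isNoetherianRing (Submonoid.powers (discriminant k I)) _ inferInstance

instance : QuasiCompact (crossRatios k I).left :=
  have : IsNoetherian (Conf k I).left :=
    inferInstanceAs (IsNoetherian (Spec (.of (ConfRing k I))))
  inferInstance

/-- The stable curve `ℙ¹` with marked points given by a configuration. -/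
def toMBar : specOver k (ConfRing k I) ⟶ MBar k I :=
  Over.homMk (crossRatios k I).left.toImage
    ((Scheme.Hom.toImage_imageι_assoc _ _).trans (Over.w (crossRatios k I)))

/-- The cross-ratio embedding. -/
def mbarι : MBar k I ⟶ QuadProd k I := Over.homMk (crossRatios k I).left.imageι rfl

instance : Mono (mbarι k I) :=
  have : Mono (mbarι k I).left := inferInstanceAs (Mono (crossRatios k I).left.imageι)
  Over.mono_of_mono_left _

instance : IsDominant (toMBar k I).left :=
  inferInstanceAs (IsDominant (crossRatios k I).left.toImage)

variable {I} in
/-- The coordinate of the product of projective lines with index `t`. -/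
def quadπ (t : Fin 4 ↪ I) : QuadProd k I ⟶ P1 k := Pi.π (fun _ ↦ P1 k) t

variable {I} in
/-- The cross-ratio of four marked points as a function on the space of stable curves. -/
def mbarCoord (t : Fin 4 ↪ I) : MBar k I ⟶ P1 k := mbarι k I ≫ quadπ k t

lemma toMBar_mbarCoord (t : Fin 4 ↪ I) : toMBar k I ≫ mbarCoord k t =
    ratio (br k I (t 0) (t 2) * br k I (t 1) (t 3)) (br k I (t 0) (t 3) * br k I (t 1) (t 2))
      ((isUnit_br k (by simp)).mul (isUnit_br k (by simp))) := by
  have h1 : crossRatios k I ≫ quadπ k t = crossRatio k t := Pi.lift_π _ _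
  refine Eq.trans ?_ h1
  ext1
  change (crossRatios k I).left.toImage ≫ (crossRatios k I).left.imageι ≫ (quadπ k t).left =
    (crossRatios k I).left ≫ (quadπ k t).left
  rw [Scheme.Hom.toImage_imageι_assoc]

variable {k I} in
lemma mbar_hom_ext {T : Over (Spec (.of k))} {f g : T ⟶ MBar k I}
    (h : ∀ t : Fin 4 ↪ I, f ≫ mbarCoord k t = g ≫ mbarCoord k t) : f = g := by
  rw [← cancel_mono (mbarι k I)]
  refine Pi.hom_ext _ _ fun t ↦ ?_
  exact (Category.assoc _ _ _).trans ((h t).trans (Category.assoc _ _ _).symm)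

variable {k I} in
/-- Configurations with proportional brackets have the same stable curve. -/
lemma specOverMap_toMBar_eq {R : Type u} [CommRing R] [Algebra k R]
    {φ ψ : ConfRing k I →ₐ[k] R} (c : R) (μ : I → R)
    (h : ∀ i j, i ≠ j → φ (br k I i j) = c * μ i * μ j * ψ (br k I i j)) :
    specOverMap φ ≫ toMBar k I = specOverMap ψ ≫ toMBar k I := by
  refine mbar_hom_ext fun t ↦ ?_
  -- Each of the four indices occurs once in the numerator and once in the denominator of a
  -- cross-ratio, so the weights `μ` and the factor `c` contribute equally to both.
  rw [Category.assoc, Category.assoc, toMBar_mbarCoord, specOverMap_ratio, specOverMap_ratio,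
    ratio_eq_iff]
  simp only [map_mul]
  rw [h _ _ (t.injective.ne (by decide)), h _ _ (t.injective.ne (by decide)),
    h _ _ (t.injective.ne (by decide)), h _ _ (t.injective.ne (by decide))]
  ring

variable {k I} in
/-- Bringing a configuration into normalised position does not change its stable curve. -/
lemma normalise_toMBar [DecidableEq I] {o a b : I} (hao : a ≠ o) (hbo : b ≠ o) (hab : a ≠ b) :
    specOverMap (stdHom k o (normCoord k o a b) (separated_normCoord hao hbo hab)) ≫
      toMBar k I = toMBar k I := by
  have hr {i j : I} (h : i ≠ j) := Ring.mul_inverse_cancel _ (isUnit_br k h)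
  -- The change of coordinates multiplies all brackets by the constant factor and by a weight for
  -- each point. The weight of `i ≠ o` is `1 / [i o]`, and the weight at `o` is the one that makes
  -- the brackets with `o` equal to `±1`.
  have key := specOverMap_toMBar_eq (k := k)
    (φ := stdHom k o (normCoord k o a b) (separated_normCoord hao hbo hab))
    (ψ := AlgHom.id k _)
    (br k I a o * br k I b o * Ring.inverse (br k I b a))
    (fun i ↦ if i = o then - br k I b a * Ring.inverse (br k I a o) * Ring.inverse (br k I b o)
      else Ring.inverse (br k I i o)) (by
    intro i j hij
    rw [stdHom_br]
    simp only [AlgHom.id_apply]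
    by_cases hi : i = o
    · subst hi
      have hj := hij.symm
      rw [coordBracket_left _ _ hj, if_pos rfl, if_neg hj, br_swap i j]
      have h5 : br k I a i * Ring.inverse (br k I a i) * (br k I b i * Ring.inverse (br k I b i)) *
          (br k I b a * Ring.inverse (br k I b a)) * (br k I j i * Ring.inverse (br k I j i)) =
          1 := by
        rw [hr hao, hr hbo, hr hab.symm, hr hj]; ring
      linear_combination -h5
    by_cases hj : j = o
    · subst hj
      rw [coordBracket_right _ _ hi, if_pos rfl, if_neg hi]
      have h5 : br k I a j * Ring.inverse (br k I a j) * (br k I b j * Ring.inverse (br k I b j)) *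
          (br k I b a * Ring.inverse (br k I b a)) * (br k I i j * Ring.inverse (br k I i j)) =
          1 := by
        rw [hr hao, hr hbo, hr hab.symm, hr hi]; ring
      linear_combination h5
    rw [coordBracket_of_ne _ _ hi hj, if_neg hi, if_neg hj]
    have h1 := normCoord_sub (k := k) hi hj hab
    have h2 := hr hi
    have h3 := hr hj
    have h4 := hr hab.symm
    generalize Ring.inverse (br k I i o) = x at *
    generalize Ring.inverse (br k I j o) = y at *
    generalize Ring.inverse (br k I b a) = z at *
    have h5 : br k I i o * x * (br k I j o * y) * (br k I b a * z) = 1 := by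
      rw [h2, h3, h4]; ring
    linear_combination x * y * z * h1 -
      (normCoord k o a b i - normCoord k o a b j) * h5)
  rw [key, specOverMap_id, Category.id_comp]

/-- `MBar` is a scheme-theoretic image, so its functions embed into functions on configurations.
This strengthens topological density and lets identities on `MBar` be checked in `ConfRing`. -/
lemma toMBar_app_injective (W : (MBar k I).left.Opens) :
    Function.Injective ((toMBar k I).left.app W) :=
  TopCat.Presheaf.app_injective_of_stalkFunctor_map_injective
    (F := (MBar k I).left.sheaf) (toMBar k I).left.c W
    fun x _ ↦ (crossRatios k I).left.stalkFunctor_toImage_injective x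

/-- The open subscheme where no cross-ratio is infinite. It consists of the smooth curves. -/
def smoothLocus : (MBar k I).left.Opens where
  carrier := {x | ∀ t : Fin 4 ↪ I, (mbarCoord k t).left x ∈ chart k}
  is_open' := by
    simp only [Set.ofPred_forall]
    exact isOpen_iInter_of_finite fun t ↦ ((mbarCoord k t).left ⁻¹ᵁ chart k).2

lemma toMBar_mem_smoothLocus (x) : (toMBar k I).left x ∈ smoothLocus k I := fun t ↦ by
  have h : (mbarCoord k t).left ((toMBar k I).left x) = (toMBar k I ≫ mbarCoord k t).left x := rfl
  rw [h, toMBar_mbarCoord]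
  exact ratio_mem_chart _ _ _ _

lemma dense_smoothLocus : Dense (smoothLocus k I : Set (MBar k I).left) := by
  refine Dense.mono ?_ (toMBar k I).left.denseRange
  rintro _ ⟨x, rfl⟩
  exact toMBar_mem_smoothLocus k I x

/-- Transfers injectivity on sections to an open subscheme: functions on `O` can then be compared
after pulling them back to `R`. -/
lemma exists_injective_of_opensOver {X : Over (Spec (.of k))} {O : X.left.Opens} {R : Type u}
    [CommRing R] [Algebra k R] (g : specOver k R ⟶ opensOver X O)
    (hg : ∀ W, Function.Injective ((g ≫ opensOverι X O).left.app W)) :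
    ∃ ρ : Sections (opensOver X O) →ₐ[k] R,
      g ≫ toSpecSections _ = specOverMap ρ ∧ Function.Injective ρ := by
  obtain ⟨ρ, hρ⟩ := exists_eq_specOverMap (g ≫ toSpecSections _)
  refine ⟨ρ, hρ, ?_⟩
  have h1 := eq_appTop_of_comp_toSpecΓ (T := (opensOver X O).left) (R := .of R) g.left
    (CommRingCat.ofHom ρ.toRingHom) (congrArg CommaMorphism.left hρ)
  have h2 := appTop_injective_of_comp_ι (O := O) g.left (hg _)
  intro x y hxy
  apply h2
  apply (ConcreteCategory.bijective_of_isIso (Scheme.ΓSpecIso (.of R)).hom).1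
  have h3 (z) : (Scheme.ΓSpecIso (.of R)).hom (g.left.appTop z) = ρ z :=
    (congrArg (fun f : Γ((opensOver X O).left, ⊤) ⟶ CommRingCat.of R ↦ f.hom z) h1).symm
  exact (h3 x).trans (hxy.trans (h3 y).symm)

end StableCurves

/-! ### Normalised coordinates on the smooth locus -/

section Retraction

variable {k : Type u} [Field k] {I : Type} [Fintype I] [DecidableEq I]

omit [Fintype I] [DecidableEq I] in
lemma exists_quadruple {x₀ x₁ x₂ x₃ : I} (h₀₁ : x₀ ≠ x₁) (h₀₂ : x₀ ≠ x₂) (h₀₃ : x₀ ≠ x₃)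
    (h₁₂ : x₁ ≠ x₂) (h₁₃ : x₁ ≠ x₃) (h₂₃ : x₂ ≠ x₃) :
    ∃ t : Fin 4 ↪ I, t 0 = x₀ ∧ t 1 = x₁ ∧ t 2 = x₂ ∧ t 3 = x₃ := by
  refine ⟨⟨![x₀, x₁, x₂, x₃], ?_⟩, rfl, rfl, rfl, rfl⟩
  intro p q hpq
  fin_cases p <;> fin_cases q <;> simp_all

/-- On the smooth locus, the normalised coordinates are regular functions. They provide a
retraction onto the normalised configurations. -/
theorem exists_retraction {o a b : I} (hao : a ≠ o) (hbo : b ≠ o) (hab : a ≠ b) :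
    ∃ r : opensOver (MBar k I) (smoothLocus k I) ⟶ specOver k (ConfRing k I),
      r ≫ toMBar k I = opensOverι (MBar k I) (smoothLocus k I) ∧
      ∀ q : specOver k (ConfRing k I) ⟶ opensOver (MBar k I) (smoothLocus k I),
        q ≫ opensOverι (MBar k I) (smoothLocus k I) = toMBar k I →
        q ≫ r = specOverMap
          (stdHom k o (normCoord k o a b) (separated_normCoord hao hbo hab)) := by
  set T := opensOver (MBar k I) (smoothLocus k I) with hT
  set ι := opensOverι (MBar k I) (smoothLocus k I) with hι
  obtain ⟨q, hq⟩ := exists_opensOver_lift (toMBar k I) (toMBar_mem_smoothLocus k I)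
  obtain ⟨ρ, hρ, hρinj⟩ := exists_injective_of_opensOver k (R := ConfRing k I) q (by
    intro W
    have h := toMBar_app_injective k I W
    rw [← hq] at h
    exact h)
  -- The smooth locus is not yet known to be affine, so the cross-ratios are handled as its global
  -- sections and compared through the injection `ρ`.
  have hf (t : Fin 4 ↪ I) : ∃ f : Sections T, ι ≫ mbarCoord k t =
      toSpecSections T ≫ ratio f 1 isUnit_one :=
    exists_eq_ratio _ fun x ↦ opensOverι_mem (MBar k I) (smoothLocus k I) x t
  choose f hf using hf
  have hu {i j : I} (h : i ≠ j) : IsUnit (br k I i j) := isUnit_br k h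
  have ht (t : Fin 4 ↪ I) {i j : Fin 4} (h : i ≠ j) : IsUnit (br k I (t i) (t j)) :=
    hu (t.injective.ne h)
  have hρf (t : Fin 4 ↪ I) : ρ (f t) * (br k I (t 0) (t 3) * br k I (t 1) (t 2)) =
      br k I (t 0) (t 2) * br k I (t 1) (t 3) := by
    have h1 : specOverMap ρ ≫ ratio (f t) 1 isUnit_one = toMBar k I ≫ mbarCoord k t := by
      rw [← hρ, Category.assoc, ← hf, ← Category.assoc, hq]
    rw [toMBar_mbarCoord, specOverMap_ratio, ratio_eq_iff] at h1
    simpa using h1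
  have hunit (t : Fin 4 ↪ I) : IsUnit (f t) := by
    -- Exchanging the last two points inverts the cross-ratio. Since no cross-ratio is infinite,
    -- none vanishes.
    let t' := (Equiv.swap (2 : Fin 4) 3).toEmbedding.trans t
    refine IsUnit.of_mul_eq_one (f t') (hρinj ?_)
    have h1 := hρf t
    have h2 : ρ (f t') * (br k I (t 0) (t 2) * br k I (t 1) (t 3)) =
      br k I (t 0) (t 3) * br k I (t 1) (t 2) := hρf t'
    rw [map_mul, map_one]
    apply ((ht t (show (0 : Fin 4) ≠ 3 by decide)).mul
      (ht t (show (1 : Fin 4) ≠ 2 by decide))).mul_left_injective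
    linear_combination ρ (f t') * h1 + h2
  have hw' (i : I) (hio : i ≠ o) (hia : i ≠ a) : ∃ w : Sections T,
      ρ w = normCoord k o a b i ∧ IsUnit w := by
    by_cases hib : i = b
    · subst hib
      exact ⟨1, by rw [map_one, normCoord_b hbo hab], isUnit_one⟩
    -- The cross-ratio of `(i, b, a, o)` is the normalised coordinate of `i`.
    obtain ⟨t, h0, h1, h2, h3⟩ := exists_quadruple hib hia hio hab.symm hbo hao
    refine ⟨f t, ?_, hunit t⟩
    have h4 := hρf t
    have h5 := normCoord_mul (k := k) (o := o) (a := a) (b := b) hio hab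
    rw [h0, h1, h2, h3] at h4
    apply ((hu hio).mul (hu hab.symm)).mul_left_injective
    exact h4.trans h5.symm
  have hw (i : I) : ∃ w : Sections T, i ≠ o → ρ w = normCoord k o a b i := by
    by_cases hio : i = o
    · exact ⟨0, fun h ↦ absurd hio h⟩
    by_cases hia : i = a
    · exact ⟨0, fun _ ↦ by rw [map_zero, hia, normCoord_a]⟩
    obtain ⟨w, h, -⟩ := hw' i hio hia
    exact ⟨w, fun _ ↦ h⟩
  choose w hw using hw
  have hwa : w a = 0 := hρinj (by rw [hw a hao, map_zero, normCoord_a])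
  have hwunit (i : I) (hio : i ≠ o) (hia : i ≠ a) : IsUnit (w i) := by
    obtain ⟨w', h1, h2⟩ := hw' i hio hia
    rwa [hρinj ((hw i hio).trans h1.symm)]
  have hsep : Separated o w := by
    intro i j hi hj hij
    by_cases hia : i = a
    · rw [hia, hwa, zero_sub]
      exact (hwunit j hj fun h ↦ hij (hia.trans h.symm)).neg
    by_cases hja : j = a
    · rw [hja, hwa, sub_zero]
      exact hwunit i hi hia
    -- With `o` at infinity and `a` at `0`, the cross-ratio of `(j, a, i, o)` is `(w i - w j) / w
    -- i`. Differences are therefore units as well.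
    obtain ⟨t, h0, h1, h2, h3⟩ := exists_quadruple hja hij.symm hj (Ne.symm hia) hao hi
    have key : w i - w j = w i * f t := by
      apply hρinj
      have h4 := hρf t
      have h5 := normCoord_mul (k := k) (o := o) (a := a) (b := b) hi hab
      have h6 := normCoord_sub (k := k) (o := o) (a := a) (b := b) hi hj hab
      rw [h0, h1, h2, h3, br_swap a i, br_swap j i] at h4
      rw [map_sub, map_mul, hw i hi, hw j hj]
      apply ((((hu hi).mul (hu hj)).mul (hu hab.symm)).mul (hu hia)).mul_left_injective
      linear_combination br k I i a * h6 +
        normCoord k o a b i * br k I i o * br k I b a * h4 -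
        br k I i j * br k I a o * h5
    rw [key]
    exact (hwunit i hi hia).mul (hunit t)
  have hcomp : ρ.comp (stdHom k o w hsep) =
      stdHom k o (normCoord k o a b) (separated_normCoord hao hbo hab) := by
    rw [comp_stdHom]
    exact stdHom_congr (fun i hi ↦ hw i hi) _ _
  refine ⟨toSpecSections T ≫ specOverMap (stdHom k o w hsep), ?_, ?_⟩
  · refine mbar_hom_ext fun t ↦ ?_
    rw [hf, Category.assoc, Category.assoc, toMBar_mbarCoord, specOverMap_ratio]
    congr 1
    rw [ratio_eq_iff]
    apply hρinj
    simp only [map_mul, ← AlgHom.comp_apply, mul_one]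
    rw [hcomp]
    have h2 := congrArg (· ≫ mbarCoord k t) (normalise_toMBar (k := k) hao hbo hab)
    simp only [Category.assoc] at h2
    rw [toMBar_mbarCoord, specOverMap_ratio, ratio_eq_iff] at h2
    apply ((ht t (show (0 : Fin 4) ≠ 3 by decide)).mul
      (ht t (show (1 : Fin 4) ≠ 2 by decide))).mul_left_injective
    have h3 := hρf t
    simp only [map_mul] at *
    linear_combination h2 - stdHom k o (normCoord k o a b) (separated_normCoord hao hbo hab)
      (br k I (t 0) (t 3)) * stdHom k o (normCoord k o a b) (separated_normCoord hao hbo hab)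
      (br k I (t 1) (t 2)) * h3
  · intro q' hq'
    have : q' = q := (cancel_mono ι).mp (hq'.trans hq.symm)
    rw [this, ← Category.assoc, hρ, specOverMap_comp, hcomp]

end Retraction

/-! ### Parameter spaces of normalised configurations -/

section ParameterSpace

variable (k : Type u) [Field k] {ι : Type} [Fintype ι] {J : ι → Type} [∀ j, Fintype (J j)]
  [∀ j, DecidableEq (J j)] (o a b : ∀ j, J j)

/-- The points of the members of a family that are not among the three normalised points. -/
abbrev FreePoint {ι : Type} {J : ι → Type} (o a b : ∀ j, J j) : Type :=
  Σ j, {i : J j // i ≠ o j ∧ i ≠ a j ∧ i ≠ b j}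

/-- The generic normalised positions: `0` for the point `a j`, `1` for the point `b j`,
and a free variable for every other point different from `o j`. -/
def genericPos (j : ι) (i : J j) : MvPolynomial (FreePoint o a b) k :=
  if h : i ≠ o j ∧ i ≠ a j ∧ i ≠ b j then .X ⟨j, i, h⟩ else if i = b j then 1 else 0

omit [Fintype ι] [∀ j, Fintype (J j)] in
lemma genericPos_free {j : ι} {i : J j} (h : i ≠ o j ∧ i ≠ a j ∧ i ≠ b j) :
    genericPos k o a b j i = .X ⟨j, i, h⟩ := by
  rw [genericPos, dif_pos h]

omit [Fintype ι] [∀ j, Fintype (J j)] in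
lemma genericPos_b (j : ι) : genericPos k o a b j (b j) = 1 := by
  simp [genericPos]

omit [Fintype ι] [∀ j, Fintype (J j)] in
lemma genericPos_a {j : ι} (hab : a j ≠ b j) : genericPos k o a b j (a j) = 0 := by
  simp [genericPos, hab]

omit [Fintype ι] [∀ j, Fintype (J j)] in
lemma genericPos_injective (hab : ∀ j, a j ≠ b j) {j : ι} {i i' : J j} (hi : i ≠ o j)
    (hi' : i' ≠ o j) (h : genericPos k o a b j i = genericPos k o a b j i') : i = i' := by
  have hX0 (x) : (MvPolynomial.X x : MvPolynomial (FreePoint o a b) k) ≠ 0 :=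
    MvPolynomial.X_ne_zero x
  have hX1 (x) : (MvPolynomial.X x : MvPolynomial (FreePoint o a b) k) ≠ 1 := fun h ↦ by
    have := congrArg MvPolynomial.totalDegree h
    simp at this
  have h01 : (0 : MvPolynomial (FreePoint o a b) k) ≠ 1 := zero_ne_one
  have hcases (i : J j) (hi : i ≠ o j) : i = a j ∨ i = b j ∨ (i ≠ o j ∧ i ≠ a j ∧ i ≠ b j) := by
    tauto
  rcases hcases i hi with rfl | rfl | hf <;> rcases hcases i' hi' with h1 | h1 | hf'
  · exact h1.symm
  · rw [h1, genericPos_a k o a b (hab j), genericPos_b] at h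
    exact absurd h h01
  · rw [genericPos_a k o a b (hab j), genericPos_free k o a b hf'] at h
    exact absurd h.symm (hX0 _)
  · rw [h1, genericPos_a k o a b (hab j), genericPos_b] at h
    exact absurd h.symm h01
  · exact h1.symm
  · rw [genericPos_b, genericPos_free k o a b hf'] at h
    exact absurd h.symm (hX1 _)
  · rw [h1, genericPos_a k o a b (hab j), genericPos_free k o a b hf] at h
    exact absurd h (hX0 _)
  · rw [h1, genericPos_b, genericPos_free k o a b hf] at h
    exact absurd h (hX1 _)
  · rw [genericPos_free k o a b hf, genericPos_free k o a b hf'] at h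
    have := MvPolynomial.X_injective h
    simpa using this

/-- The product of the brackets of the generic normalised configurations. -/
def paramDiscriminant : MvPolynomial (FreePoint o a b) k :=
  ∏ j, ∏ p ∈ (Finset.univ : Finset (J j)).offDiag,
    coordBracket (o j) (genericPos k o a b j) p.1 p.2

/-- The generic positions within one member are `0`, `1` and distinct variables, so no factor
vanishes. This makes the parameter ring a domain containing the polynomial ring. -/
lemma paramDiscriminant_ne_zero (hab : ∀ j, a j ≠ b j) : paramDiscriminant k o a b ≠ 0 := by
  refine Finset.prod_ne_zero_iff.mpr fun j _ ↦ Finset.prod_ne_zero_iff.mpr ?_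
  rintro ⟨i, i'⟩ hp
  have hne : i ≠ i' := (Finset.mem_offDiag.mp hp).2.2
  by_cases hi : i = o j
  · subst hi
    rw [coordBracket_left _ _ hne.symm]
    exact one_ne_zero
  by_cases hi' : i' = o j
  · subst hi'
    rw [coordBracket_right _ _ hi]
    exact neg_ne_zero.mpr one_ne_zero
  rw [coordBracket_of_ne _ _ hi hi', sub_ne_zero]
  exact fun h ↦ hne (genericPos_injective k o a b hab hi hi' h)

/-- The coordinate ring of the space of families of normalised configurations. -/
abbrev ParamRing : Type u := Localization.Away (paramDiscriminant k o a b)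

lemma isDomain_paramRing (hab : ∀ j, a j ≠ b j) : IsDomain (ParamRing k o a b) :=
  IsLocalization.isDomain_localization
    (powers_le_nonZeroDivisors_of_noZeroDivisors (paramDiscriminant_ne_zero k o a b hab))

lemma paramRing_algebraMap_injective (hab : ∀ j, a j ≠ b j) :
    Function.Injective (algebraMap (MvPolynomial (FreePoint o a b) k) (ParamRing k o a b)) :=
  IsLocalization.injective _
    (powers_le_nonZeroDivisors_of_noZeroDivisors (paramDiscriminant_ne_zero k o a b hab))

/-- The normalised positions as elements of the coordinate ring. -/
def paramPos (j : ι) (i : J j) : ParamRing k o a b :=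
  algebraMap (MvPolynomial (FreePoint o a b) k) _ (genericPos k o a b j i)

lemma paramPos_a {j : ι} (hab : a j ≠ b j) : paramPos k o a b j (a j) = 0 := by
  rw [paramPos, genericPos_a k o a b hab, map_zero]

lemma paramPos_b (j : ι) : paramPos k o a b j (b j) = 1 := by
  rw [paramPos, genericPos_b, map_one]

lemma paramPos_free {j : ι} {i : J j} (h : i ≠ o j ∧ i ≠ a j ∧ i ≠ b j) :
    paramPos k o a b j i = algebraMap (MvPolynomial (FreePoint o a b) k) _ (.X ⟨j, i, h⟩) := by
  rw [paramPos, genericPos_free]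

lemma separated_paramPos (j : ι) : Separated (o j) (paramPos k o a b j) := by
  intro i i' hi hi' hne
  have h1 : coordBracket (o j) (genericPos k o a b j) i i' ∣ paramDiscriminant k o a b :=
    (Finset.dvd_prod_of_mem
      (fun p : J j × J j ↦ coordBracket (o j) (genericPos k o a b j) p.1 p.2)
      (a := (i, i')) (by simpa using hne)).trans
      (Finset.dvd_prod_of_mem (fun j ↦ ∏ p ∈ (Finset.univ : Finset (J j)).offDiag,
        coordBracket (o j) (genericPos k o a b j) p.1 p.2) (Finset.mem_univ j))
  rw [coordBracket_of_ne _ _ hi hi'] at h1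
  have h2 := isUnit_of_dvd_unit (map_dvd (algebraMap _ (ParamRing k o a b)) h1)
    (IsLocalization.Away.algebraMap_isUnit (S := ParamRing k o a b) (paramDiscriminant k o a b))
  rwa [map_sub] at h2

variable {k o a b} {R : Type u} [CommRing R] [Algebra k R]

lemma paramRing_algHom_ext {φ ψ : ParamRing k o a b →ₐ[k] R}
    (h : ∀ j i, i ≠ o j → φ (paramPos k o a b j i) = ψ (paramPos k o a b j i)) : φ = ψ := by
  have : φ.toRingHom = ψ.toRingHom := by
    apply IsLocalization.ringHom_ext (Submonoid.powers (paramDiscriminant k o a b))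
    refine MvPolynomial.ringHom_ext (fun c ↦ ?_) ?_
    · have h1 := φ.commutes c
      have h2 := ψ.commutes c
      rw [IsScalarTower.algebraMap_apply k (MvPolynomial (FreePoint o a b) k)
        (ParamRing k o a b)] at h1 h2
      exact h1.trans h2.symm
    · rintro ⟨j, i, hi⟩
      have := h j i hi.1
      rw [paramPos_free k o a b hi] at this
      exact this
  exact AlgHom.ext fun x ↦ RingHom.congr_fun this x

/-- The universal property of the coordinate ring of the parameter space. -/
lemma exists_paramRing_algHom (v : ∀ j, J j → R) (ha : ∀ j, v j (a j) = 0)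
    (hb : ∀ j, v j (b j) = 1) (hab : ∀ j, a j ≠ b j) (hv : ∀ j, Separated (o j) (v j)) :
    ∃ χ : ParamRing k o a b →ₐ[k] R, ∀ j i, i ≠ o j → χ (paramPos k o a b j i) = v j i := by
  let χ₀ : MvPolynomial (FreePoint o a b) k →ₐ[k] R := MvPolynomial.aeval fun p ↦ v p.1 p.2
  have h₀ (j : ι) (i : J j) (hi : i ≠ o j) : χ₀ (genericPos k o a b j i) = v j i := by
    by_cases hia : i = a j
    · rw [hia, genericPos_a k o a b (hab j), map_zero, ha]
    by_cases hib : i = b j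
    · rw [hib, genericPos_b, map_one, hb]
    rw [genericPos_free k o a b ⟨hi, hia, hib⟩]
    exact MvPolynomial.aeval_X _ _
  have hunit : IsUnit (χ₀ (paramDiscriminant k o a b)) := by
    rw [paramDiscriminant, map_prod]
    refine IsUnit.prod_iff.mpr fun j _ ↦ ?_
    rw [map_prod]
    refine IsUnit.prod_iff.mpr ?_
    rintro ⟨i, i'⟩ hp
    have hne : i ≠ i' := (Finset.mem_offDiag.mp hp).2.2
    by_cases hi : i = o j
    · subst hi
      rw [coordBracket_left _ _ hne.symm, map_one]
      exact isUnit_one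
    by_cases hi' : i' = o j
    · subst hi'
      rw [coordBracket_right _ _ hi, map_neg, map_one]
      exact isUnit_one.neg
    rw [coordBracket_of_ne _ _ hi hi', map_sub, h₀ j i hi, h₀ j i' hi']
    exact hv j i i' hi hi' hne
  refine ⟨IsLocalization.liftAlgHom (M := Submonoid.powers (paramDiscriminant k o a b))
    (f := χ₀) (by
      rintro ⟨_, m, rfl⟩
      rw [map_pow]
      exact hunit.pow m), fun j i hi ↦ ?_⟩
  rw [paramPos, IsLocalization.liftAlgHom_apply, IsLocalization.lift_eq]
  exact h₀ j i hi

omit [Fintype ι] in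
lemma dense_biInter_finset {X : Type*} [TopologicalSpace X] (S : Finset ι) {f : ι → Set X}
    (ho : ∀ j, IsOpen (f j)) (hd : ∀ j, Dense (f j)) : Dense (⋂ j ∈ S, f j) := by
  classical
  induction S using Finset.induction_on with
  | empty => simp
  | insert j S _ ih =>
    rw [Finset.set_biInter_insert]
    exact (hd j).inter_of_isOpen_left ih (ho j)

/-- A product of spaces of stable curves contains the parameter space of families of normalised
configurations as a dense open subscheme. -/
theorem exists_dense_chart (hao : ∀ j, a j ≠ o j) (hbo : ∀ j, b j ≠ o j) (hab : ∀ j, a j ≠ b j)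
    {Y : Over (Spec (.of k))} (π : ∀ j, Y ⟶ MBar k (J j))
    (hlift : ∀ (T : Over (Spec (.of k))) (f : ∀ j, T ⟶ MBar k (J j)),
      ∃ g : T ⟶ Y, ∀ j, g ≫ π j = f j)
    (hext : ∀ (T : Over (Spec (.of k))) (g g' : T ⟶ Y), (∀ j, g ≫ π j = g' ≫ π j) → g = g')
    (hopen : ∀ j, IsOpenMap (π j).left) :
    ∃ s : specOver k (ParamRing k o a b) ⟶ Y,
      (∀ j, s ≫ π j = specOverMap (stdHom k (o j) (paramPos k o a b j)
        (separated_paramPos k o a b j)) ≫ toMBar k (J j)) ∧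
      IsOpenImmersion s.left ∧ IsDominant s.left := by
  -- `hlift` and `hext` say that `Y` is the product of the `MBar k (J j)`. In this form the argument
  -- covers both a chosen product and a single factor with the identity as projection.
  let σ (j : ι) : ConfRing k (J j) →ₐ[k] ParamRing k o a b :=
    stdHom k (o j) (paramPos k o a b j) (separated_paramPos k o a b j)
  obtain ⟨s, hs⟩ := hlift _ fun j ↦ specOverMap (σ j) ≫ toMBar k (J j)
  -- The chart will be the locus where all members are smooth. It is dense because preimages of
  -- dense sets under open maps are dense.
  let O : Y.left.Opens :=
    { carrier := {y | ∀ j, (π j).left y ∈ smoothLocus k (J j)}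
      is_open' := by
        simp only [Set.ofPred_forall]
        exact isOpen_iInter_of_finite fun j ↦ ((π j).left ⁻¹ᵁ smoothLocus k (J j)).2 }
  have hO : Dense (O : Set Y.left) := by
    have h1 : (O : Set Y.left) = ⋂ j ∈ Finset.univ,
        (π j).left ⁻¹' (smoothLocus k (J j) : Set (MBar k (J j)).left) := by
      ext y
      simp [O]
    rw [h1]
    exact dense_biInter_finset _ (fun j ↦ ((π j).left ⁻¹ᵁ smoothLocus k (J j)).2)
      fun j ↦ (dense_smoothLocus k (J j)).preimage (hopen j)
  let T := opensOver Y O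
  obtain ⟨s', hs'⟩ := exists_opensOver_lift (O := O) s (by
    intro x j
    have h : (π j).left (s.left x) = (s ≫ π j).left x := rfl
    rw [h, hs]
    exact toMBar_mem_smoothLocus k (J j) _)
  have hτ (j : ι) := exists_opensOver_lift (O := smoothLocus k (J j))
    (opensOverι Y O ≫ π j) (fun x ↦ opensOverι_mem Y O x j)
  choose τ hτ using hτ
  have hr (j : ι) := exists_retraction (k := k) (hao j) (hbo j) (hab j)
  choose r hr hqr using hr
  have hq (j : ι) := exists_opensOver_lift (toMBar k (J j)) (toMBar_mem_smoothLocus k (J j))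
  choose q hq using hq
  have hθ (j : ι) := exists_eq_toSpecSections_comp (τ j ≫ r j)
  choose θ hθ using hθ
  let u (j : ι) := normCoord k (o j) (a j) (b j)
  have hu (j : ι) : Separated (o j) (u j) := separated_normCoord (hao j) (hbo j) (hab j)
  obtain ⟨χ, hχ⟩ := exists_paramRing_algHom (k := k) (o := o) (a := a) (b := b)
    (fun j i ↦ θ j (u j i)) (fun j ↦ by simp [u, normCoord_a])
    (fun j ↦ by simp [u, normCoord_b (hbo j) (hab j)]) hab (fun j ↦ (hu j).map (θ j))
  let h : T ⟶ specOver k (ParamRing k o a b) := toSpecSections T ≫ specOverMap χ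
  -- `h` reads off the normalised coordinates of every member. It is inverse to `s'` because
  -- normalising does not change a stable curve, and because a configuration already normalised is
  -- its own normal form.
  have hhs : h ≫ s = opensOverι Y O := by
    refine hext _ _ _ fun j ↦ ?_
    have h1 : χ.comp (σ j) = (θ j).comp (stdHom k (o j) (u j) (hu j)) := by
      rw [comp_stdHom, comp_stdHom]
      exact stdHom_congr (hχ j) _ _
    rw [Category.assoc, hs, Category.assoc, specOverMap_comp_assoc, h1, ← specOverMap_comp_assoc,
      normalise_toMBar (hao j) (hbo j) (hab j), ← Category.assoc, ← hθ, Category.assoc, hr, hτ]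
  have hsh : s' ≫ h = 𝟙 _ := by
    obtain ⟨κ, hκ⟩ := exists_eq_specOverMap (s' ≫ toSpecSections T)
    have h1 (j : ι) : s' ≫ τ j = specOverMap (σ j) ≫ q j := by
      rw [← cancel_mono (opensOverι _ _), Category.assoc, hτ, ← Category.assoc, hs', hs,
        Category.assoc, hq]
    have h2 (j : ι) : κ.comp (θ j) = (σ j).comp (stdHom k (o j) (u j) (hu j)) := by
      apply specOverMap_injective
      rw [← specOverMap_comp, ← hκ, Category.assoc, ← hθ, ← Category.assoc, h1, Category.assoc,
        hqr j (q j) (hq j), specOverMap_comp]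
    have h3 : κ.comp χ = AlgHom.id k _ := by
      refine paramRing_algHom_ext fun j i hi ↦ ?_
      have hσu (i : J j) (hi : i ≠ o j) : σ j (u j i) = paramPos k o a b j i := by
        have := stdHom_normCoord (k := k) (hao j) (hbo j) (hab j) (separated_paramPos k o a b j) hi
        simpa [paramPos_a k o a b (hab j), paramPos_b] using this
      have h4 : (σ j).comp (stdHom k (o j) (u j) (hu j)) = σ j := by
        rw [comp_stdHom]
        exact stdHom_congr hσu _ _
      rw [AlgHom.comp_apply, hχ j i hi, ← AlgHom.comp_apply, h2, h4, hσu i hi, AlgHom.id_apply]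
    rw [← Category.assoc, hκ, specOverMap_comp, h3, specOverMap_id]
  have hhs' : h ≫ s' = 𝟙 _ := by
    rw [← cancel_mono (opensOverι Y O), Category.assoc, hs', hhs, Category.id_comp]
  have hiso : IsIso s'.left :=
    ⟨h.left, congrArg CommaMorphism.left hsh, congrArg CommaMorphism.left hhs'⟩
  have hsl : s'.left ≫ (opensOverι Y O).left = s.left := congrArg CommaMorphism.left hs'
  refine ⟨s, hs, ?_, ?_⟩
  · rw [← hsl]
    infer_instance
  · constructor
    refine Dense.mono ?_ hO
    intro y hy
    refine ⟨h.left (⟨y, hy⟩ : O), ?_⟩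
    have h5 : s.left (h.left (⟨y, hy⟩ : O)) = (h ≫ s).left (⟨y, hy⟩ : O) := rfl
    rw [h5, hhs]
    rfl

end ParameterSpace

/-! ### Products and forgetful morphisms in coordinates -/

section Products

variable {k : Type u} [Field k]

/-- The projections of a product of schemes over a field are open. -/
lemma isOpenMap_pi_left {ι : Type} [Finite ι] (M : ι → Over (Spec (.of k))) (j : ι) :
    IsOpenMap (Pi.π M j).left := by
  classical
  let Z := ∏ᶜ fun i : {i // i ≠ j} ↦ M i
  let q : ∏ᶜ M ⟶ Z := Pi.lift fun i ↦ Pi.π M i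
  have hq (i : {i // i ≠ j}) : q ≫ Pi.π (fun i : {i // i ≠ j} ↦ M i) i = Pi.π M i := Pi.lift_π _ _
  let lft (T : Over (Spec (.of k))) (f : T ⟶ M j) (g : T ⟶ Z) : T ⟶ ∏ᶜ M := Pi.lift fun i ↦
    if h : i = j then f ≫ eqToHom (by rw [h]) else g ≫ Pi.π (fun i : {i // i ≠ j} ↦ M i) ⟨i, h⟩
  have hl1 (T : Over (Spec (.of k))) (f : T ⟶ M j) (g : T ⟶ Z) : lft T f g ≫ Pi.π M j = f := by
    simp [lft]
  have hl2 (T : Over (Spec (.of k))) (f : T ⟶ M j) (g : T ⟶ Z) : lft T f g ≫ q = g := by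
    refine Pi.hom_ext _ _ fun i ↦ ?_
    rw [Category.assoc, hq]
    simp [lft, i.2]
  have hlim : IsLimit (BinaryFan.mk (Pi.π M j) q) :=
    BinaryFan.IsLimit.mk _ (fun {T} f g ↦ lft T f g) (fun {T} f g ↦ hl1 T f g)
      (fun {T} f g ↦ hl2 T f g) (fun {T} f g m h1 h2 ↦ by
        refine Pi.hom_ext (f := M) m (lft T f g) fun i ↦ ?_
        by_cases h : i = j
        · subst h
          exact h1.trans (hl1 T f g).symm
        · have h3 := congrArg (· ≫ Pi.π (fun i : {i // i ≠ j} ↦ M i) ⟨i, h⟩) (h2.trans (hl2 T f g).symm)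
          simp only [BinaryFan.mk_snd, Category.assoc] at h3
          rw [hq] at h3
          exact (congrArg (m ≫ ·) (hq ⟨i, h⟩)).symm.trans ((Category.assoc _ _ _).symm.trans h3))
  -- The product splits as `M j` times the product `Z` of the other factors, so the projection is a
  -- base change of `Z` to `Spec k`, which is universally open over a field.
  have hp := Over.isPullback_of_binaryFan_isLimit _ hlim
  have hopen : UniversallyOpen Z.hom := inferInstance
  have : UniversallyOpen (Pi.π M j).left :=
    MorphismProperty.of_isPullback (P := @UniversallyOpen) hp.flip hopen
  exact (Pi.π M j).left.isOpenMap

variable {I J : Type} [Fintype I] [Fintype J] (e : J ↪ I)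

lemma forget_mbarι : forget k e ≫ mbarι k J = mbarι k I ≫ quadProj k e := by
  have h : (crossRatios k J).left.ker ≤
      (crossRatios k I).left.ker.map (quadProj k e).left := by
    rw [Scheme.IdealSheafData.map_ker, ← Over.comp_left, ← confForget_crossRatios, Over.comp_left]
    exact Scheme.Hom.le_ker_comp _ _
  ext1
  exact Scheme.IdealSheafData.subschemeMap_subschemeι _ _ _ h

lemma forget_mbarCoord (t : Fin 4 ↪ J) :
    forget k e ≫ mbarCoord k t = mbarCoord k (t.trans e) := by
  have h : quadProj k e ≫ quadπ k t = quadπ k (t.trans e) := Pi.lift_π _ _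
  rw [mbarCoord, ← Category.assoc, forget_mbarι, Category.assoc, h, mbarCoord]

lemma toMBar_forget :
    toMBar k I ≫ forget k e = specOverMap (confRestrict k e) ≫ toMBar k J := by
  refine mbar_hom_ext fun t ↦ ?_
  rw [Category.assoc, Category.assoc, forget_mbarCoord, toMBar_mbarCoord, toMBar_mbarCoord,
    specOverMap_ratio, ratio_eq_iff]
  simp only [map_mul, confRestrict_br]
  rfl

variable {R : Type u} [CommRing R] [Algebra k R] [DecidableEq I] [DecidableEq J]

/-- Affine changes of coordinates do not change the stable curve. -/
lemma specOverMap_stdHom_forget {o : I} {o' : J} (ho : e o' = o) {v : I → R} (hv : Separated o v)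
    {w : J → R} (hw : Separated o' w) {c : R} (hc : IsUnit c)
    (h : ∀ i j, i ≠ o' → j ≠ o' → v (e i) - v (e j) = c * (w i - w j)) :
    specOverMap (stdHom k o v hv) ≫ toMBar k I ≫ forget k e =
      specOverMap (stdHom k o' w hw) ≫ toMBar k J := by
  subst ho
  have hcc := Ring.mul_inverse_cancel _ hc
  rw [toMBar_forget, specOverMap_comp_assoc]
  -- Brackets of two finite points scale by `c`, whereas those with the point at infinity stay `±1`.
  -- The weight `c⁻¹` at `o'` compensates for this.
  refine specOverMap_toMBar_eq c (fun i ↦ if i = o' then Ring.inverse c else 1) fun i j hij ↦ ?_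
  rw [AlgHom.comp_apply, confRestrict_br, stdHom_br, stdHom_br]
  by_cases hi : i = o'
  · subst hi
    have hj := hij.symm
    rw [coordBracket_left _ _ hj, coordBracket_left _ _ (e.injective.ne hj), if_pos rfl, if_neg hj,
      hcc]
    ring
  by_cases hj : j = o'
  · subst hj
    rw [coordBracket_right _ _ hi, coordBracket_right _ _ (e.injective.ne hi), if_pos rfl,
      if_neg hi]
    linear_combination hcc
  rw [coordBracket_of_ne _ _ hi hj, coordBracket_of_ne _ _ (e.injective.ne hi) (e.injective.ne hj),
    if_neg hi, if_neg hj, h i j hi hj]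
  ring

end Products

/-! ### Hypergraph morphisms in normalised coordinates -/

section Charts

variable (k : Type u) [Field k] {I : Type} [Fintype I] [DecidableEq I] {d : ℕ}
  (Γ : Fin d → Finset I)

/-- In suitable dense open affine charts, a hypergraph morphism is given by normalising the
positions of the points of each hyperedge. -/
theorem exists_hypergraph_chart {o a b : I} (hao : a ≠ o) (hbo : b ≠ o) (hab : a ≠ b)
    (o' a' b' : ∀ j, Γ j) (ho' : ∀ j, (o' j : I) = o) (hao' : ∀ j, a' j ≠ o' j)
    (hbo' : ∀ j, b' j ≠ o' j) (hab' : ∀ j, a' j ≠ b' j) :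
    ∃ (s : specOver k (ParamRing k (fun _ : Unit ↦ o) (fun _ ↦ a) (fun _ ↦ b)) ⟶ MBar k I)
      (s' : specOver k (ParamRing k o' a' b') ⟶ ∏ᶜ fun j : Fin d ↦ MBar k (Γ j))
      (φ : ParamRing k o' a' b' →ₐ[k] ParamRing k (fun _ : Unit ↦ o) (fun _ ↦ a) (fun _ ↦ b)),
      IsOpenImmersion s.left ∧ IsDominant s.left ∧ IsOpenImmersion s'.left ∧ IsDominant s'.left ∧
      s ≫ hypergraphMorphism k Γ = specOverMap φ ≫ s' ∧
      ∀ j i, i ≠ o' j → φ (paramPos k o' a' b' j i) *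
          (paramPos k (fun _ : Unit ↦ o) (fun _ ↦ a) (fun _ ↦ b) () (b' j) -
            paramPos k (fun _ : Unit ↦ o) (fun _ ↦ a) (fun _ ↦ b) () (a' j)) =
        paramPos k (fun _ : Unit ↦ o) (fun _ ↦ a) (fun _ ↦ b) () i -
          paramPos k (fun _ : Unit ↦ o) (fun _ ↦ a) (fun _ ↦ b) () (a' j) := by
  obtain ⟨s, hs, hs1, hs2⟩ := exists_dense_chart (k := k) (ι := Unit) (J := fun _ ↦ I)
    (o := fun _ ↦ o) (a := fun _ ↦ a) (b := fun _ ↦ b) (fun _ ↦ hao) (fun _ ↦ hbo) (fun _ ↦ hab)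
    (Y := MBar k I) (fun _ ↦ 𝟙 _) (fun T f ↦ ⟨f (), fun _ ↦ Category.comp_id _⟩)
    (fun T g g' h ↦ by simpa using h ()) (fun _ ↦ IsOpenMap.id)
  obtain ⟨s', hs', hs1', hs2'⟩ := exists_dense_chart (k := k) hao' hbo' hab'
    (Y := ∏ᶜ fun j : Fin d ↦ MBar k (Γ j)) (fun j ↦ Pi.π _ j)
    (fun T f ↦ ⟨Pi.lift f, fun j ↦ Pi.lift_π _ _⟩) (fun T g g' h ↦ Pi.hom_ext _ _ h)
    (fun j ↦ isOpenMap_pi_left _ j)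
  set v := paramPos k (fun _ : Unit ↦ o) (fun _ ↦ a) (fun _ ↦ b) () with hv
  have hsep : Separated o v := separated_paramPos k (fun _ : Unit ↦ o) (fun _ ↦ a) (fun _ ↦ b) ()
  have hne {j} {i : Γ j} (hi : i ≠ o' j) : (i : I) ≠ o := fun h ↦
    hi (Subtype.ext (h.trans (ho' j).symm))
  let c (j : Fin d) := v (b' j) - v (a' j)
  have hc (j : Fin d) : IsUnit (c j) := hsep _ _ (hne (hbo' j)) (hne (hao' j))
    fun h ↦ hab' j (Subtype.ext h.symm)
  have hcc (j : Fin d) := Ring.mul_inverse_cancel _ (hc j)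
  -- The affine map taking `a' j` to `0` and `b' j` to `1`. It fixes the common point at infinity,
  -- which is why `ho'` asks every hyperedge to contain `o`.
  let w (j : Fin d) (i : Γ j) := (v i - v (a' j)) * Ring.inverse (c j)
  have hwsub (j : Fin d) (i i' : Γ j) : v i - v i' = c j * (w j i - w j i') := by
    linear_combination (- (v i - v i')) * hcc j
  have hw (j : Fin d) : Separated (o' j) (w j) := by
    intro i i' hi hi' hii
    have := hsep i i' (hne hi) (hne hi') fun h ↦ hii (Subtype.ext h)
    rw [hwsub] at this
    exact isUnit_of_mul_isUnit_right this
  obtain ⟨φ, hφ⟩ := exists_paramRing_algHom (k := k) (o := o') (a := a') (b := b') w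
    (fun j ↦ by simp [w]) (fun j ↦ hcc j) hab' hw
  refine ⟨s, s', φ, hs1, hs2, hs1', hs2', ?_, fun j i hi ↦ ?_⟩
  · refine Pi.hom_ext _ _ fun j ↦ ?_
    have h1 : hypergraphMorphism k Γ ≫ Pi.π (fun j : Fin d ↦ MBar k (Γ j)) j =
        forget k (Function.Embedding.subtype (· ∈ Γ j)) := Pi.lift_π _ _
    have h2 : s = specOverMap (stdHom k o v hsep) ≫ toMBar k I := by simpa using hs ()
    rw [Category.assoc, h1, Category.assoc, hs', specOverMap_comp_assoc, comp_stdHom, h2,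
      Category.assoc]
    refine (specOverMap_stdHom_forget (k := k) (Function.Embedding.subtype (· ∈ Γ j)) (ho' j) hsep
      (hw j) (hc j) (fun i i' _ _ ↦ hwsub j i i')).trans ?_
    rw [stdHom_congr (fun i hi ↦ (hφ j i hi).symm) (hw j)
      ((separated_paramPos k o' a' b' j).map φ)]
  · rw [hφ j i hi]
    linear_combination (v i - v (a' j)) * hcc j

end Charts

/-! ### Dominance and birationality in affine charts -/

section AffineCharts

variable {A B : Type u} [CommRing A] [CommRing B] [IsDomain A] [IsDomain B] {X Y : Scheme.{u}}

omit [IsDomain B] in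
lemma isDominant_specMap_iff (φ : A →+* B) :
    IsDominant (Spec.map (CommRingCat.ofHom φ)) ↔ Function.Injective φ := by
  rw [isDominant_iff, RingHom.injective_iff_ker_eq_bot, ← le_bot_iff, ← Submodule.zero_eq_bot,
    ← nilradical_eq_zero A]
  exact PrimeSpectrum.denseRange_comap_iff_ker_le_nilRadical φ

variable {f : X ⟶ Y} {s : Spec (.of B) ⟶ X} {s' : Spec (.of A) ⟶ Y} {φ : A →+* B}

-- Since `A` is reduced, `Spec B ⟶ Spec A` is dominant exactly when the kernel is zero. Composition
-- with the dominant `s` does not affect dominance, and density in `Y` restricts to density in the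
-- open chart.
omit [IsDomain B] in
lemma isDominant_iff_injective [IsDominant s] [IsOpenImmersion s'] [IsDominant s']
    (h : s ≫ f = Spec.map (CommRingCat.ofHom φ) ≫ s') :
    IsDominant f ↔ Function.Injective φ := by
  rw [← isDominant_specMap_iff, ← IsDominant.comp_iff (f := s), h]
  constructor
  · intro h1
    constructor
    have h2 := h1.1.preimage s'.isOpenEmbedding.isOpenMap
    refine h2.mono ?_
    rintro x ⟨y, hy⟩
    exact ⟨y, s'.isOpenEmbedding.injective hy⟩
  · intro _
    infer_instance

lemma IsBirational.isDominant (hf : IsBirational f) : IsDominant f := by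
  obtain ⟨g, hg⟩ := hf
  have : IsDominant g.target.ι := Opens.isDominant_ι g.dense_target
  have : IsDominant (g.source.ι ≫ f) := hg ▸ inferInstance
  exact IsDominant.of_comp g.source.ι f

lemma isIso_stalkMap_comp_iff {Z : Scheme.{u}} (f : X ⟶ Y) (g : Y ⟶ Z) [IsOpenImmersion f]
    (x : X) : IsIso ((f ≫ g).stalkMap x) ↔ IsIso (g.stalkMap (f x)) := by
  rw [Scheme.Hom.stalkMap_comp]
  exact isIso_comp_right_iff (g.stalkMap (f x)) (f.stalkMap x)

lemma isIso_stalkMap_comp_iff' {Z : Scheme.{u}} (f : X ⟶ Y) (g : Y ⟶ Z) [IsOpenImmersion g]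
    (x : X) : IsIso ((f ≫ g).stalkMap x) ↔ IsIso (f.stalkMap x) := by
  rw [Scheme.Hom.stalkMap_comp]
  exact isIso_comp_left_iff (g.stalkMap (f x)) (f.stalkMap x)

omit [IsDomain A] in
/-- In affine charts, a birational morphism induces a surjection onto the field of fractions. -/
lemma IsBirational.exists_mul_eq [IsOpenImmersion s] [IsOpenImmersion s']
    (h : s ≫ f = Spec.map (CommRingCat.ofHom φ) ≫ s') (hf : IsBirational f) (x : B) :
    ∃ c g : A, φ c ≠ 0 ∧ φ c * x = φ g := by
  obtain ⟨g, hg⟩ := hf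
  -- The generic point of `Spec B` lies in every non-empty open set, in particular in the domain of
  -- the partial isomorphism. There the stalk map is an isomorphism onto the field of fractions of
  -- `B`.
  let p₀ : PrimeSpectrum B := ⊥
  let p : Spec (.of B) := p₀
  have hp : s p ∈ g.source := by
    have h1 : (s ⁻¹ᵁ g.source : Set (Spec (.of B))).Nonempty := by
      obtain ⟨y, hy1, hy2⟩ := g.dense_source.inter_open_nonempty _
        s.isOpenEmbedding.isOpen_range ⟨_, ⟨p, rfl⟩⟩
      obtain ⟨z, rfl⟩ := hy1
      exact ⟨z, hy2⟩
    obtain ⟨z, hz⟩ := h1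
    have h2 : p ⤳ z := (PrimeSpectrum.le_iff_specializes (⊥ : PrimeSpectrum B) z).mp bot_le
    exact h2.mem_open (s ⁻¹ᵁ g.source).2 hz
  let p' : g.source.toScheme := ⟨s p, hp⟩
  have h1 : IsIso ((g.source.ι ≫ f).stalkMap p') := by
    rw [← hg, isIso_stalkMap_comp_iff]
    infer_instance
  have h2 : IsIso (f.stalkMap (s p)) := (isIso_stalkMap_comp_iff g.source.ι f p').mp h1
  rw [← isIso_stalkMap_comp_iff s f p, h, isIso_stalkMap_comp_iff'] at h2
  have h3 := ((MorphismProperty.isomorphisms _).arrow_mk_iso_iff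
    (Scheme.arrowStalkMapSpecIso (CommRingCat.ofHom φ) p)).mp h2
  have h4 : Function.Surjective (Localization.localRingHom
    (PrimeSpectrum.comap φ p₀).asIdeal p₀.asIdeal φ (PrimeSpectrum.comap_asIdeal φ p₀)) := by
    have : IsIso (CommRingCat.ofHom (Localization.localRingHom
      (PrimeSpectrum.comap φ p₀).asIdeal p₀.asIdeal φ (PrimeSpectrum.comap_asIdeal φ p₀))) := h3
    exact (ConcreteCategory.bijective_of_isIso (CommRingCat.ofHom (Localization.localRingHom
      (PrimeSpectrum.comap φ p₀).asIdeal p₀.asIdeal φ (PrimeSpectrum.comap_asIdeal φ p₀)))).2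
  obtain ⟨z, hz⟩ := h4 (algebraMap B _ x)
  obtain ⟨a, c, rfl⟩ := IsLocalization.exists_mk'_eq (PrimeSpectrum.comap φ p₀).asIdeal.primeCompl z
  -- The denominator `c` avoids the preimage of the zero ideal, that is, the kernel of `φ`.
  have hc : φ c ≠ 0 := fun h ↦ c.2 h
  refine ⟨c, a, hc, ?_⟩
  rw [Localization.localRingHom_mk', IsLocalization.mk'_eq_iff_eq_mul, ← map_mul] at hz
  have hinj : Function.Injective (algebraMap B (Localization.AtPrime p₀.asIdeal)) :=
    IsLocalization.injective _ (Ideal.primeCompl_le_nonZeroDivisors p₀.asIdeal)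
  rw [mul_comm]
  exact (hinj hz).symm

/-- A dominant morphism that, in affine charts, induces a surjection onto the field of fractions is
birational. -/
lemma isBirational_of_exists_mul_eq [IsOpenImmersion s] [IsDominant s] [IsOpenImmersion s']
    [IsDominant s'] (h : s ≫ f = Spec.map (CommRingCat.ofHom φ) ≫ s') (hφ : Function.Injective φ)
    (hfin : φ.FiniteType) (hx : ∀ x : B, ∃ c g : A, φ c ≠ 0 ∧ φ c * x = φ g) :
    IsBirational f := by
  algebraize [φ]
  obtain ⟨S, hS⟩ := ‹Algebra.FiniteType A B›.out
  choose c g hc hcg using hx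
  -- A common denominator for a finite set of generators of `B` over `A`. Inverting it makes `φ`
  -- bijective, and the resulting principal open subsets are the dense opens required.
  let a := ∏ x ∈ S, c x
  have ha : φ a ≠ 0 := by
    rw [map_prod]
    exact Finset.prod_ne_zero_iff.mpr fun x _ ↦ hc x
  have key (x : B) : ∃ m y, φ (a ^ m) * x = φ y := by
    have hx : x ∈ Algebra.adjoin A (S : Set B) := hS ▸ trivial
    induction hx using Algebra.adjoin_induction with
    | mem x hx =>
      obtain ⟨r, hr⟩ : c x ∣ a := Finset.dvd_prod_of_mem _ hx
      refine ⟨1, r * g x, ?_⟩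
      rw [pow_one, hr, map_mul, map_mul, ← hcg]
      ring
    | algebraMap r => exact ⟨0, r, by simp [RingHom.algebraMap_toAlgebra]⟩
    | add x y _ _ hx hy =>
      obtain ⟨m, x', hx⟩ := hx
      obtain ⟨n, y', hy⟩ := hy
      refine ⟨m + n, a ^ n * x' + a ^ m * y', ?_⟩
      simp only [map_add, map_mul, ← hx, ← hy, pow_add]
      ring
    | mul x y _ _ hx hy =>
      obtain ⟨m, x', hx⟩ := hx
      obtain ⟨n, y', hy⟩ := hy
      refine ⟨m + n, x' * y', ?_⟩
      simp only [map_mul, ← hx, ← hy, pow_add]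
      ring
  let ψ : Localization.Away a →+* Localization.Away (φ a) := Localization.awayMap φ a
  have ha0 : a ≠ 0 := fun h ↦ ha (by rw [h, map_zero])
  have hiA : Function.Injective (algebraMap A (Localization.Away a)) :=
    IsLocalization.injective _ (powers_le_nonZeroDivisors_of_noZeroDivisors ha0)
  have hiB : Function.Injective (algebraMap B (Localization.Away (φ a))) :=
    IsLocalization.injective _ (powers_le_nonZeroDivisors_of_noZeroDivisors ha)
  have hψ (y : A) : ψ (algebraMap A _ y) = algebraMap B _ (φ y) :=
    IsLocalization.map_eq _ _
  have hψb : Function.Bijective ψ := by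
    constructor
    · refine IsLocalization.map_injective_of_injective' _ _ _ _ ?_ hφ
      rintro ⟨m, hm⟩
      exact pow_ne_zero m ha hm
    · intro z
      obtain ⟨x, ⟨_, n, rfl⟩, rfl⟩ := IsLocalization.exists_mk'_eq (Submonoid.powers (φ a)) z
      obtain ⟨m, y, hy⟩ := key x
      refine ⟨IsLocalization.mk' _ y (⟨a ^ (m + n), m + n, rfl⟩ : Submonoid.powers a), ?_⟩
      rw [eq_comm, IsLocalization.mk'_eq_iff_eq_mul]
      have h1 := congrArg ψ (IsLocalization.mk'_spec (Localization.Away a) y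
        (⟨a ^ (m + n), m + n, rfl⟩ : Submonoid.powers a))
      rw [map_mul, hψ, hψ, ← hy] at h1
      have h2 : IsUnit (algebraMap B (Localization.Away (φ a)) (φ (a ^ m))) := by
        rw [map_pow, map_pow]
        exact (IsLocalization.Away.algebraMap_isUnit (φ a)).pow m
      apply h2.mul_right_injective
      simp only [pow_add, map_mul, map_pow] at h1 ⊢
      linear_combination -h1
  let q : Spec (.of (Localization.Away (φ a))) ⟶ Spec (.of (Localization.Away a)) :=
    Spec.map (CommRingCat.ofHom ψ)
  have hq : IsIso q := by
    have : IsIso (CommRingCat.ofHom ψ) := (ConcreteCategory.isIso_iff_bijective _).mpr hψb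
    infer_instance
  let i : Spec (.of (Localization.Away (φ a))) ⟶ X :=
    Spec.map (CommRingCat.ofHom (algebraMap B (Localization.Away (φ a)))) ≫ s
  let i' : Spec (.of (Localization.Away a)) ⟶ Y :=
    Spec.map (CommRingCat.ofHom (algebraMap A (Localization.Away a))) ≫ s'
  have h1 : IsOpenImmersion (Spec.map (CommRingCat.ofHom (algebraMap B (Localization.Away (φ a))))) :=
    IsOpenImmersion.of_isLocalization (φ a)
  have h2 : IsOpenImmersion (Spec.map (CommRingCat.ofHom (algebraMap A (Localization.Away a)))) :=
    IsOpenImmersion.of_isLocalization a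
  have h3 := (isDominant_specMap_iff _).mpr hiA
  have h4 := (isDominant_specMap_iff _).mpr hiB
  have hcomm : i ≫ f = q ≫ i' := by
    have h5 : CommRingCat.ofHom φ ≫ CommRingCat.ofHom (algebraMap B (Localization.Away (φ a))) =
        CommRingCat.ofHom (algebraMap A (Localization.Away a)) ≫ CommRingCat.ofHom ψ := by
      ext y
      exact (hψ y).symm
    rw [Category.assoc, h, ← Category.assoc, ← Spec.map_comp, h5, Spec.map_comp, Category.assoc]
  refine ⟨⟨i.opensRange, ?_, i'.opensRange, ?_,
    i.isoOpensRange.symm ≪≫ asIso q ≪≫ i'.isoOpensRange⟩, ?_⟩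
  · exact i.denseRange
  · exact i'.denseRange
  · rw [← cancel_epi i.isoOpensRange.hom]
    simp [← hcomm]

end AffineCharts

/-! ### Dimension counts -/

section DimensionCounts

variable {k F : Type*} [Field k] [Field F] [Algebra k F] {D P N : Type*} {e : P → D} {v : P → N}
  {a b : D → N} {U : P → F}

lemma solutionSpace_affine {x : N → F} (hx : x ∈ solutionSpace e v a b U) (c c' : F) :
    (fun i ↦ (x i - c) * c') ∈ solutionSpace e v a b U := fun p ↦ by
  linear_combination c' * hx p

/-- Algebraically independent normalised positions satisfy the Hall condition. -/
lemma card_filter_add_two_le [Fintype P] [DecidableEq N] [DecidableEq D]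
    (hU : AlgebraicIndependent k U) {x : N → F} (hx : x ∈ solutionSpace e v a b U)
    (hab : ∀ j, x (a j) ≠ x (b j)) {S : Finset D} (hS : S.Nonempty) :
    (Finset.univ.filter (e · ∈ S)).card + 2 ≤
      (S.biUnion fun j ↦ {a j, b j} ∪ (Finset.univ.filter (e · = j)).image v).card := by
  set T := S.biUnion fun j ↦ {a j, b j} ∪ (Finset.univ.filter (e · = j)).image v with hT
  obtain ⟨j₀, hj₀⟩ := hS
  have haT {j} (hj : j ∈ S) : a j ∈ T := Finset.mem_biUnion.mpr ⟨j, hj, by simp⟩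
  have hbT {j} (hj : j ∈ S) : b j ∈ T := Finset.mem_biUnion.mpr ⟨j, hj, by simp⟩
  have hvT {p} (hp : e p ∈ S) : v p ∈ T := Finset.mem_biUnion.mpr
    ⟨e p, hp, Finset.mem_union_right _ (Finset.mem_image_of_mem _ (by simp))⟩
  -- Ratios are invariant under affine maps, so two points of `T` can be placed at `0` and `1`,
  -- where they contribute nothing to the generated field. This accounts for the `2` in the
  -- inequality.
  let y (i : N) : F := (x i - x (a j₀)) * (x (b j₀) - x (a j₀))⁻¹
  have hya : y (a j₀) = 0 := by simp [y]
  have hyb : y (b j₀) = 1 := mul_inv_cancel₀ (sub_ne_zero.mpr (hab j₀).symm)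
  have hy : y ∈ solutionSpace e v a b U := solutionSpace_affine hx _ _
  have hyab (j : D) : y (b j) - y (a j) ≠ 0 := by
    have : y (b j) - y (a j) = (x (b j) - x (a j)) * (x (b j₀) - x (a j₀))⁻¹ := by
      simp only [y]; ring
    rw [this]
    exact mul_ne_zero (sub_ne_zero.mpr (hab j).symm) (inv_ne_zero (sub_ne_zero.mpr (hab j₀).symm))
  let T' := (T.erase (a j₀)).erase (b j₀)
  let s : Set F := y '' T'
  have hmem {i : N} (hi : i ∈ T) : y i ∈ IntermediateField.adjoin k s := by
    by_cases hia : i = a j₀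
    · rw [hia, hya]
      exact zero_mem _
    by_cases hib : i = b j₀
    · rw [hib, hyb]
      exact one_mem _
    exact IntermediateField.subset_adjoin _ _ ⟨i, by simp [T', hia, hib, hi], rfl⟩
  have h1 := card_le_of_algebraicIndependent_of_mem_adjoin (P := {p // e p ∈ S})
    (hU.comp _ Subtype.val_injective) s (by
    rintro ⟨p, hp⟩
    have h2 : U p = (y (v p) - y (a (e p))) / (y (b (e p)) - y (a (e p))) := by
      rw [eq_div_iff (hyab _)]
      exact (hy p).symm
    change U p ∈ _
    rw [h2]
    exact div_mem (sub_mem (hmem (hvT hp)) (hmem (haT hp)))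
      (sub_mem (hmem (hbT hp)) (hmem (haT hp))))
  have h2 : s.ncard ≤ T'.card := (Set.ncard_image_le T'.finite_toSet).trans (by simp)
  have hne : b j₀ ≠ a j₀ := fun h ↦ hab j₀ (by rw [h])
  have h3 : T'.card + 1 = (T.erase (a j₀)).card :=
    Finset.card_erase_add_one (Finset.mem_erase.mpr ⟨hne, hbT hj₀⟩)
  have h4 : (T.erase (a j₀)).card + 1 = T.card := Finset.card_erase_add_one (haT hj₀)
  rw [Fintype.card_subtype] at h1
  lia

/-- Under the Hall condition, there are pairwise distinct points with prescribed algebraically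
independent normalised positions. -/
lemma exists_injective_solution [Infinite k] [Finite D] [Finite N] [Fintype P] [DecidableEq N]
    [DecidableEq D] (hU : AlgebraicIndependent k U)
    (hHall : ∀ S : Finset D, S.Nonempty → (Finset.univ.filter (e · ∈ S)).card + 2 ≤
      (S.biUnion fun j ↦ {a j, b j} ∪ (Finset.univ.filter (e · = j)).image v).card)
    {α β : N} (hαβ : α ≠ β) :
    ∃ x ∈ solutionSpace e v a b U, Function.Injective x ∧ x α = 0 ∧ x β = 1 := by
  -- Each pair of distinct points becomes an extra segment with no dividing points, so
  -- non-degeneracy of all segments means injectivity. The Hall condition persists: extra segments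
  -- add no ratios, and alone they already involve two points.
  let D' := D ⊕ {q : N × N // q.1 ≠ q.2}
  obtain ⟨x, hx, hne⟩ := exists_nondegenerate_solution (D := D') (e := fun p ↦ Sum.inl (e p))
    (v := v) (a := Sum.elim a fun q ↦ q.1.1) (b := Sum.elim b fun q ↦ q.1.2) hU (by
    intro S hS
    by_cases hL : S.toLeft.Nonempty
    · refine (le_trans (le_of_eq ?_) (hHall _ hL)).trans (Finset.card_le_card ?_)
      · simp
      · intro i hi
        obtain ⟨j, hj, hi⟩ := Finset.mem_biUnion.mp hi
        refine Finset.mem_biUnion.mpr ⟨Sum.inl j, Finset.mem_toLeft.mp hj, ?_⟩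
        have hinl (p : P) : (Sum.inl (e p) : D') = Sum.inl j ↔ e p = j := Sum.inl_injective.eq_iff
        simpa [hinl] using hi
    · have h0 : (Finset.univ.filter fun p ↦ (Sum.inl (e p) : D') ∈ S) = ∅ := by
        rw [Finset.filter_eq_empty_iff]
        intro p _ hp
        exact hL ⟨e p, Finset.mem_toLeft.mpr hp⟩
      rw [h0, Finset.card_empty, zero_add]
      obtain ⟨j | q, hj⟩ := hS
      · exact absurd ⟨j, Finset.mem_toLeft.mpr hj⟩ hL
      · rw [← Finset.card_pair q.2]
        refine Finset.card_le_card fun i hi ↦ Finset.mem_biUnion.mpr ⟨_, hj, ?_⟩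
        exact Finset.mem_union_left _ hi)
  have hinj : Function.Injective x := fun i i' h ↦ by
    by_contra hii
    exact hne (Sum.inr ⟨(i, i'), hii⟩) h
  have h1 : x β - x α ≠ 0 := sub_ne_zero.mpr fun h ↦ hαβ (hinj h).symm
  refine ⟨fun i ↦ (x i - x α) * (x β - x α)⁻¹, solutionSpace_affine hx _ _, ?_, by simp,
    mul_inv_cancel₀ h1⟩
  intro i i' h
  exact hinj (sub_left_injective (mul_left_injective₀ (inv_ne_zero h1) h))

/-- If there are enough prescribed normalised positions, the points are rational over the field
that these generate. -/
lemma mem_adjoin_range_of_card_le [Infinite k] [Finite D] [Fintype N] [Fintype P]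
    (hU : AlgebraicIndependent k U) {x : N → F} (hx : x ∈ solutionSpace e v a b U)
    (hab : ∀ j, x (a j) ≠ x (b j)) {α β : N} (hα : x α = 0) (hβ : x β = 1)
    (hcard : Fintype.card N ≤ Fintype.card P + 2) (i : N) :
    x i ∈ IntermediateField.adjoin k (Set.range U) := by
  set K := IntermediateField.adjoin k (Set.range U) with hK
  -- The equations have coefficients in `K`, so a `K`-linear retraction of `F` onto `K`, applied to
  -- each coordinate, turns the solution `x` into a solution `y` over `K`, still with values `0` and
  -- `1` at `α` and `β`.
  obtain ⟨r, hr⟩ := (Algebra.linearMap K F).exists_leftInverse_of_injective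
    (LinearMap.ker_eq_bot.mpr (algebraMap K F).injective)
  have hr' (c : K) : r (c : F) = c := LinearMap.congr_fun hr c
  let y (i : N) : F := r (x i)
  have hy : y ∈ solutionSpace e v a b U := fun p ↦ by
    let u : K := ⟨U p, IntermediateField.subset_adjoin _ _ ⟨p, rfl⟩⟩
    have h1 : x (v p) - x (a (e p)) = u • (x (b (e p)) - x (a (e p))) := hx p
    have h2 := congrArg (fun z : F ↦ (r z : F)) h1
    simpa using h2
  have hyα : y α = 0 := by simp [y, hα]
  have hyβ : y β = 1 := by
    have h := hr' 1
    simp only [y, hβ]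
    rw [OneMemClass.coe_one] at h
    rw [h, OneMemClass.coe_one]
  suffices h : y = x from (congrFun h i) ▸ (r (x i)).2
  by_contra hne
  let W := solutionSpace e v a b U
  have h1 := finrank_add_card_le hU W le_rfl fun j ↦ ⟨x, hx, hab j⟩
  let one : W := ⟨1, fun p ↦ by simp⟩
  -- The space `W` has dimension at most `|N| - |P| ≤ 2`. If `y ≠ x`, then evaluation at `α`, at `β`
  -- and at a point where they differ would show these three solutions to be independent.
  have hli : LinearIndependent F ![one, ⟨x, hx⟩, ⟨y - x, sub_mem hy hx⟩] := by
    rw [Fintype.linearIndependent_iff]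
    intro g hg
    rw [Fin.sum_univ_three] at hg
    have hg' (i : N) : g 0 + g 1 * x i + g 2 * (y i - x i) = 0 := by
      simpa [one] using congrFun (congrArg Subtype.val hg) i
    have h0 : g 0 = 0 := by simpa [hα, hyα] using hg' α
    have h1 : g 1 = 0 := by simpa [hβ, hyβ, h0] using hg' β
    obtain ⟨i, hi⟩ := Function.ne_iff.mp hne
    have h2 : g 2 = 0 := by simpa [h0, h1, sub_ne_zero.mpr hi] using hg' i
    intro i
    fin_cases i
    exacts [h0, h1, h2]
  have h2 := hli.fintype_card_le_finrank
  simp only [Fintype.card_fin] at h2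
  lia

end DimensionCounts

/-! ### Homomorphisms from coordinate rings of parameter spaces -/

section ParamRingHom

variable {k : Type u} [Field k] {ι : Type} [Fintype ι] {J : ι → Type} [∀ j, Fintype (J j)]
  [∀ j, DecidableEq (J j)] {o a b : ∀ j, J j}

lemma algHom_algebraMap_paramRing {R : Type u} [CommRing R] [Algebra k R]
    (θ : ParamRing k o a b →ₐ[k] R) (q : MvPolynomial (FreePoint o a b) k) :
    θ (algebraMap _ _ q) =
      MvPolynomial.aeval (fun p : FreePoint o a b ↦ θ (paramPos k o a b p.1 p.2)) q := by
  have : θ.comp (IsScalarTower.toAlgHom k (MvPolynomial (FreePoint o a b) k) _) =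
      MvPolynomial.aeval (fun p : FreePoint o a b ↦ θ (paramPos k o a b p.1 p.2)) := by
    refine MvPolynomial.algHom_ext fun p ↦ ?_
    rw [MvPolynomial.aeval_X, paramPos_free k o a b p.2.2]
    rfl
  exact DFunLike.congr_fun this q

/-- Passing from the polynomial ring to its localisation does not affect injectivity: a fraction in
the kernel has its numerator in the kernel. -/
lemma injective_iff_algebraicIndependent (hab : ∀ j, a j ≠ b j) {R : Type u} [CommRing R]
    [Algebra k R] (θ : ParamRing k o a b →ₐ[k] R) :
    Function.Injective θ ↔
      AlgebraicIndependent k fun p : FreePoint o a b ↦ θ (paramPos k o a b p.1 p.2) := by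
  rw [algebraicIndependent_iff_injective_aeval]
  constructor
  · intro h x y hxy
    rw [← algHom_algebraMap_paramRing, ← algHom_algebraMap_paramRing] at hxy
    exact paramRing_algebraMap_injective k o a b hab (h hxy)
  · intro h
    rw [injective_iff_map_eq_zero]
    intro y hy
    obtain ⟨q, t, rfl⟩ := IsLocalization.exists_mk'_eq
      (Submonoid.powers (paramDiscriminant k o a b)) y
    have h1 := congrArg θ (IsLocalization.mk'_spec (ParamRing k o a b) q t)
    rw [map_mul, hy, zero_mul, algHom_algebraMap_paramRing] at h1
    have h2 : q = 0 := h (by rw [← h1, map_zero])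
    rw [h2, IsLocalization.mk'_zero]

lemma algHom_paramRing_mem_adjoin {F : Type u} [Field F] [Algebra k F]
    (θ : ParamRing k o a b →ₐ[k] F) (y : ParamRing k o a b) :
    θ y ∈ IntermediateField.adjoin k
      (Set.range fun p : FreePoint o a b ↦ θ (paramPos k o a b p.1 p.2)) := by
  have hpoly (q : MvPolynomial (FreePoint o a b) k) : θ (algebraMap _ _ q) ∈ IntermediateField.adjoin k
      (Set.range fun p : FreePoint o a b ↦ θ (paramPos k o a b p.1 p.2)) := by
    rw [algHom_algebraMap_paramRing]
    refine IntermediateField.algebra_adjoin_le_adjoin _ _ ?_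
    rw [Algebra.adjoin_range_eq_range_aeval]
    exact ⟨q, rfl⟩
  obtain ⟨q, t, rfl⟩ := IsLocalization.exists_mk'_eq
    (Submonoid.powers (paramDiscriminant k o a b)) y
  have h1 := congrArg θ (IsLocalization.mk'_spec (ParamRing k o a b) q t)
  have h2 : θ (algebraMap _ _ (t : MvPolynomial (FreePoint o a b) k)) ≠ 0 :=
    ((IsLocalization.map_units (ParamRing k o a b) t).map θ).ne_zero
  rw [map_mul, ← eq_div_iff h2] at h1
  rw [h1]
  exact div_mem (hpoly _) (hpoly _)

instance : Algebra.FiniteType k (ParamRing k o a b) :=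
  have : Algebra.FiniteType (MvPolynomial (FreePoint o a b) k) (ParamRing k o a b) :=
    IsLocalization.finiteType_of_monoid_fg (Submonoid.powers (paramDiscriminant k o a b)) _
  Algebra.FiniteType.trans (S := MvPolynomial (FreePoint o a b) k) inferInstance this

end ParamRingHom

/-! ### Injectivity and rationality of the pull-back of normalised positions -/

section PositionHom

variable {k : Type u} [Field k] [Infinite k] {ι : Type} [Fintype ι] [DecidableEq ι] {J : ι → Type}
  [∀ j, Fintype (J j)] [∀ j, DecidableEq (J j)] {o' a' b' : ∀ j, J j} {n : ℕ} {α β : Fin n}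

variable (k α β) in
/-- The coordinate ring of the space of `n` distinct points on the affine line, with the points
`α` and `β` at `0` and `1`. -/
abbrev LineRing : Type u :=
  ParamRing k (fun _ : Unit ↦ Fin.last n) (fun _ ↦ α.castSucc) (fun _ ↦ β.castSucc)

variable (k α β) in
/-- The universal positions of `n` distinct points on the affine line. -/
def linePos (i : Fin n) : LineRing k α β :=
  paramPos k (fun _ : Unit ↦ Fin.last n) (fun _ ↦ α.castSucc) (fun _ ↦ β.castSucc) () i.castSucc

variable (hab' : ∀ j, a' j ≠ b' j) (hαβ : α ≠ β) {φ : ParamRing k o' a' b' →ₐ[k] LineRing k α β}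
  {v : FreePoint o' a' b' → Fin n} {a b : ι → Fin n} (hab : ∀ j, a j ≠ b j)
  (hφ : ∀ p : FreePoint o' a' b', φ (paramPos k o' a' b' p.1 p.2) *
    (linePos k α β (b p.1) - linePos k α β (a p.1)) =
      linePos k α β (v p) - linePos k α β (a p.1))

-- The dictionary with similarity systems: segments are the members of the family, prescribed ratios
-- are the images of the free coordinates, and the universal positions, evaluated in a field, are a
-- solution.
include hφ in
omit [Infinite k] [DecidableEq ι] in
lemma linePos_mem_solutionSpace {F : Type u} [Field F] [Algebra k F]
    (θ : LineRing k α β →ₐ[k] F) : (fun i ↦ θ (linePos k α β i)) ∈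
      solutionSpace (fun p : FreePoint o' a' b' ↦ p.1) v a b
        (fun p ↦ θ (φ (paramPos k o' a' b' p.1 p.2))) := fun p ↦ by
  simpa using (congrArg θ (hφ p)).symm

omit [Infinite k] in
lemma isUnit_linePos_sub {i j : Fin n} (hij : i ≠ j) :
    IsUnit (linePos k α β i - linePos k α β j) :=
  separated_paramPos k (fun _ : Unit ↦ Fin.last n) (fun _ ↦ α.castSucc) (fun _ ↦ β.castSucc) ()
    _ _ (Fin.castSucc_ne_last i) (Fin.castSucc_ne_last j)
    fun h ↦ hij (Fin.castSucc_injective n h)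

omit [Infinite k] in
lemma map_linePos_ne {F : Type u} [Field F] [Algebra k F] (θ : LineRing k α β →ₐ[k] F)
    {i j : Fin n} (hij : i ≠ j) : θ (linePos k α β i) ≠ θ (linePos k α β j) := by
  rw [← sub_ne_zero, ← map_sub]
  exact ((isUnit_linePos_sub hij).map θ).ne_zero

include hab' hαβ hab hφ in
/-- Injectivity of the pull-back of normalised positions is equivalent to the Hall condition. -/
theorem injective_iff_hall : Function.Injective φ ↔ ∀ S : Finset ι, S.Nonempty →
    (Finset.univ.filter fun p : FreePoint o' a' b' ↦ p.1 ∈ S).card + 2 ≤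
      (S.biUnion fun j ↦ {a j, b j} ∪
        (Finset.univ.filter fun p : FreePoint o' a' b' ↦ p.1 = j).image v).card := by
  have hαβ' : α.castSucc ≠ β.castSucc := fun h ↦ hαβ (Fin.castSucc_injective n h)
  have hdom : IsDomain (LineRing k α β) := isDomain_paramRing _ _ _ _ fun _ ↦ hαβ'
  constructor
  · intro hinj S hS
    -- Injectivity makes the ratios of the universal positions algebraically independent in the
    -- fraction field, so the counting bound applies to them.
    let θ : LineRing k α β →ₐ[k] FractionRing (LineRing k α β) :=
      IsScalarTower.toAlgHom k _ _
    have hθ : Function.Injective θ := IsFractionRing.injective _ _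
    have hU := (injective_iff_algebraicIndependent hab' (θ.comp φ)).mp (hθ.comp hinj)
    exact card_filter_add_two_le hU (linePos_mem_solutionSpace hφ θ)
      (fun j ↦ map_linePos_ne θ (hab j)) hS
  · intro hHall
    -- The variables themselves are prescribed as ratios. A solution with distinct points gives a
    -- point `ψ` of the source for which `ψ.comp φ` sends the free coordinates to these variables,
    -- so `φ` is injective.
    let K := FractionRing (MvPolynomial (FreePoint o' a' b') k)
    let X : FreePoint o' a' b' → K := fun p ↦ algebraMap (MvPolynomial (FreePoint o' a' b') k) K (MvPolynomial.X p)
    have hX : AlgebraicIndependent k X :=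
      (MvPolynomial.algebraicIndependent_X _ k).map' (f := IsScalarTower.toAlgHom k _ K)
        (IsFractionRing.injective _ _)
    obtain ⟨x, hx, hxinj, hxα, hxβ⟩ := exists_injective_solution hX hHall hαβ
    -- The value `0` at the last index is a dummy, since that point sits at infinity.
    let w : Unit → Fin (n + 1) → K := fun _ ↦ Fin.lastCases 0 x
    have hw (i : Fin n) : w () i.castSucc = x i := Fin.lastCases_castSucc _
    obtain ⟨ψ, hψ⟩ := exists_paramRing_algHom (k := k) (o := fun _ : Unit ↦ Fin.last n)
      (a := fun _ ↦ α.castSucc) (b := fun _ ↦ β.castSucc) w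
      (fun _ ↦ (hw α).trans hxα) (fun _ ↦ (hw β).trans hxβ) (fun _ ↦ hαβ') (by
        intro _ i i' hi hi' hii
        obtain ⟨i, rfl⟩ := Fin.exists_castSucc_eq.mpr hi
        obtain ⟨i', rfl⟩ := Fin.exists_castSucc_eq.mpr hi'
        rw [hw, hw, isUnit_iff_ne_zero, sub_ne_zero]
        exact fun h ↦ hii (by rw [hxinj h]))
    have hψ' (i : Fin n) : ψ (linePos k α β i) = x i :=
      (hψ () _ (Fin.castSucc_ne_last i)).trans (hw i)
    have hψφ (p : FreePoint o' a' b') : (ψ.comp φ) (paramPos k o' a' b' p.1 p.2) = X p := by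
      have h1 := linePos_mem_solutionSpace hφ ψ p
      simp only [hψ'] at h1
      have h2 := h1.symm.trans (hx p)
      exact mul_right_cancel₀ (sub_ne_zero.mpr fun h ↦ hab p.1 (hxinj h).symm) h2
    have h3 : Function.Injective (ψ.comp φ) := by
      rw [injective_iff_algebraicIndependent hab']
      simpa only [hψφ] using hX
    exact Function.Injective.of_comp (f := ψ) (g := φ) h3

/-- At most three of the `n + 1` points are normalised. Only this direction of the count is used, so
`α` and `β` need not be distinct. -/
lemma card_le_card_freePoint_add_two : n ≤ Fintype.card (FreePoint (fun _ : Unit ↦ Fin.last n)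
    (fun _ ↦ α.castSucc) (fun _ ↦ β.castSucc)) + 2 := by
  rw [Fintype.card_sigma, Fintype.sum_unique, Fintype.card_subtype]
  have h1 : (Finset.univ : Finset (Fin (n + 1))) ⊆
      (Finset.univ.filter fun i ↦ i ≠ Fin.last n ∧ i ≠ α.castSucc ∧ i ≠ β.castSucc) ∪
        {Fin.last n, α.castSucc, β.castSucc} := by
    intro i _
    simp only [Finset.mem_union, Finset.mem_filter, Finset.mem_univ, true_and, Finset.mem_insert,
      Finset.mem_singleton]
    tauto
  have h2 := (Finset.card_le_card h1).trans (Finset.card_union_le _ _)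
  have h3 := Finset.card_le_three (a := Fin.last n) (b := α.castSucc) (c := β.castSucc)
  rw [Finset.card_univ, Fintype.card_fin] at h2
  lia

include hαβ in
omit [Infinite k] [DecidableEq ι] in
/-- If the positions are rational functions in the normalised positions, then there are enough of
the latter. -/
lemma card_le_of_exists_mul_eq (hx : ∀ y, ∃ c g, φ c ≠ 0 ∧ φ c * y = φ g) :
    n ≤ Fintype.card (FreePoint o' a' b') + 2 := by
  have hαβ' : α.castSucc ≠ β.castSucc := fun h ↦ hαβ (Fin.castSucc_injective n h)
  have hdom : IsDomain (LineRing k α β) := isDomain_paramRing _ _ _ _ fun _ ↦ hαβ'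
  let θ : LineRing k α β →ₐ[k] FractionRing (LineRing k α β) := IsScalarTower.toAlgHom k _ _
  have hθ : Function.Injective θ := IsFractionRing.injective _ _
  have hV := (injective_iff_algebraicIndependent (fun _ ↦ hαβ') θ).mp hθ
  have h1 := card_le_of_algebraicIndependent_of_mem_adjoin hV
    (Set.range fun p : FreePoint o' a' b' ↦ (θ.comp φ) (paramPos k o' a' b' p.1 p.2)) (by
    intro p
    obtain ⟨c, g, hc, hcg⟩ := hx (paramPos k (fun _ : Unit ↦ Fin.last n) (fun _ ↦ α.castSucc)
      (fun _ ↦ β.castSucc) p.1 p.2)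
    have h2 := congrArg θ hcg
    have hc' : θ (φ c) ≠ 0 := fun h ↦ hc (hθ (by rw [h, map_zero]))
    rw [map_mul, mul_comm, ← eq_div_iff hc'] at h2
    rw [h2]
    exact div_mem (algHom_paramRing_mem_adjoin (θ.comp φ) g)
      (algHom_paramRing_mem_adjoin (θ.comp φ) c))
  have h2 : (Set.range fun p : FreePoint o' a' b' ↦
      (θ.comp φ) (paramPos k o' a' b' p.1 p.2)).ncard ≤ Fintype.card (FreePoint o' a' b') := by
    rw [← Set.image_univ, ← Nat.card_eq_fintype_card, ← Set.ncard_univ]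
    exact Set.ncard_image_le
  have h3 := card_le_card_freePoint_add_two (α := α) (β := β)
  lia

include hab' hαβ hab hφ in
omit [DecidableEq ι] in
/-- If there are enough normalised positions, then the positions are rational functions in the
normalised positions. -/
lemma exists_mul_eq_of_card_le (hinj : Function.Injective φ)
    (hcard : n ≤ Fintype.card (FreePoint o' a' b') + 2) (y : LineRing k α β) :
    ∃ c g, φ c ≠ 0 ∧ φ c * y = φ g := by
  have hαβ' : α.castSucc ≠ β.castSucc := fun h ↦ hαβ (Fin.castSucc_injective n h)
  have hdom : IsDomain (LineRing k α β) := isDomain_paramRing _ _ _ _ fun _ ↦ hαβ'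
  have hdom' : IsDomain (ParamRing k o' a' b') := isDomain_paramRing _ _ _ _ hab'
  let θ : LineRing k α β →ₐ[k] FractionRing (LineRing k α β) := IsScalarTower.toAlgHom k _ _
  have hθ : Function.Injective θ := IsFractionRing.injective _ _
  let χ := θ.comp φ
  have hχ : Function.Injective χ := hθ.comp hinj
  have hU := (injective_iff_algebraicIndependent hab' χ).mp hχ
  -- The range of `L` is a subfield containing all the ratios, hence all the positions and the whole
  -- of `LineRing`. Writing a preimage as a fraction gives the required `g` and `c`.
  let L : FractionRing (ParamRing k o' a' b') →ₐ[k] FractionRing (LineRing k α β) :=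
    IsFractionRing.liftAlgHom (g := χ) hχ
  have hL (z) : L (algebraMap _ _ z) = χ z := IsFractionRing.lift_algebraMap hχ z
  have h1 : IntermediateField.adjoin k (Set.range fun p : FreePoint o' a' b' ↦
      χ (paramPos k o' a' b' p.1 p.2)) ≤ L.fieldRange := by
    rw [IntermediateField.adjoin_le_iff]
    rintro _ ⟨p, rfl⟩
    exact ⟨_, hL _⟩
  have hpos (i : Fin n) : θ (linePos k α β i) ∈ L.fieldRange := h1
    (mem_adjoin_range_of_card_le hU (linePos_mem_solutionSpace hφ θ)
      (fun j ↦ map_linePos_ne θ (hab j))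
      (by
        rw [linePos, paramPos_a _ _ _ _ hαβ', map_zero] : θ (linePos k α β α) = 0)
      (by rw [linePos, paramPos_b _ _ _ _ (), map_one] : θ (linePos k α β β) = 1)
      (by simpa using hcard) i)
  have h2 : IntermediateField.adjoin k (Set.range fun p : FreePoint (fun _ : Unit ↦ Fin.last n)
      (fun _ ↦ α.castSucc) (fun _ ↦ β.castSucc) ↦ θ (paramPos k (fun _ : Unit ↦ Fin.last n)
      (fun _ ↦ α.castSucc) (fun _ ↦ β.castSucc) p.1 p.2)) ≤ L.fieldRange := by
    rw [IntermediateField.adjoin_le_iff]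
    rintro _ ⟨⟨⟨⟩, i, hi⟩, rfl⟩
    obtain ⟨i, rfl⟩ := Fin.exists_castSucc_eq.mpr hi.1
    exact hpos i
  obtain ⟨z, hz⟩ := h2 (algHom_paramRing_mem_adjoin θ y)
  obtain ⟨g, c, rfl⟩ := IsLocalization.exists_mk'_eq (nonZeroDivisors (ParamRing k o' a' b')) z
  have hc : φ c ≠ 0 := fun h ↦ nonZeroDivisors.coe_ne_zero c (hinj (by rw [h, map_zero]))
  refine ⟨c, g, hc, hθ ?_⟩
  have h3 := congrArg L (IsLocalization.mk'_spec (FractionRing (ParamRing k o' a' b')) g c)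
  rw [map_mul, hL, hL] at h3
  have hz' : L (IsLocalization.mk' _ g c) = θ y := hz
  rw [hz'] at h3
  rw [map_mul, mul_comm]
  exact h3

end PositionHom

/-! ### Cones over hypergraphs -/

section Cones

variable {n d : ℕ} (Γ : Fin d → Finset (Fin n))

/-- The new vertex as a vertex of a hyperedge of the cone. -/
def coneApex (j : Fin d) : cone Γ j := ⟨Fin.last n, Finset.mem_insert_self _ _⟩

/-- A vertex of a hyperedge as a vertex of the corresponding hyperedge of the cone. -/
def coneVertex (j : Fin d) (i : Γ j) : cone Γ j :=
  ⟨(i : Fin n).castSucc, Finset.mem_insert_of_mem (Finset.mem_map_of_mem _ i.2)⟩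

variable {Γ}

lemma coneVertex_ne_coneApex {j : Fin d} (i : Γ j) : coneVertex Γ j i ≠ coneApex Γ j :=
  fun h ↦ Fin.castSucc_ne_last _ (congrArg Subtype.val h)

lemma coneVertex_injective (j : Fin d) : Function.Injective (coneVertex Γ j) :=
  fun _ _ h ↦ Subtype.ext (Fin.castSucc_injective n (congrArg Subtype.val h))

lemma exists_eq_coneVertex {j : Fin d} {x : cone Γ j} (hx : x ≠ coneApex Γ j) :
    ∃ i, x = coneVertex Γ j i := by
  obtain ⟨x, hx'⟩ := x
  rcases Finset.mem_insert.mp hx' with rfl | h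
  · exact absurd rfl hx
  · obtain ⟨i, hi, rfl⟩ := Finset.mem_map.mp h
    exact ⟨⟨i, hi⟩, rfl⟩

variable {a b : ∀ j, Γ j}

/-- The vertex of the hypergraph that underlies a free point of the cone. -/
def baseVertex (p : FreePoint (coneApex Γ) (fun j ↦ coneVertex Γ j (a j))
    (fun j ↦ coneVertex Γ j (b j))) : Fin n :=
  (p.2 : cone Γ p.1).1.castPred fun h ↦ p.2.2.1 (Subtype.ext h)

lemma castSucc_baseVertex (p : FreePoint (coneApex Γ) (fun j ↦ coneVertex Γ j (a j))
    (fun j ↦ coneVertex Γ j (b j))) : (baseVertex p).castSucc = (p.2 : cone Γ p.1).1 :=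
  Fin.castSucc_castPred _ _

lemma image_baseVertex (j : Fin d) :
    (Finset.univ.filter fun p : FreePoint (coneApex Γ) (fun j ↦ coneVertex Γ j (a j))
      (fun j ↦ coneVertex Γ j (b j)) ↦ p.1 = j).image baseVertex =
      ((Γ j).erase (a j)).erase (b j) := by
  ext i
  simp only [Finset.mem_image, Finset.mem_filter, Finset.mem_univ, true_and, Finset.mem_erase]
  constructor
  · rintro ⟨⟨j, x, hx⟩, rfl, rfl⟩
    obtain ⟨i, rfl⟩ := exists_eq_coneVertex hx.1
    have h1 : baseVertex ⟨j, coneVertex Γ j i, hx⟩ = i := Fin.castPred_castSucc _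
    rw [h1]
    exact ⟨fun h ↦ hx.2.2 (by rw [Subtype.ext h]), fun h ↦ hx.2.1 (by rw [Subtype.ext h]), i.2⟩
  · rintro ⟨hb, ha, hi⟩
    refine ⟨⟨j, coneVertex Γ j ⟨i, hi⟩, coneVertex_ne_coneApex _, fun h ↦ ha ?_, fun h ↦ hb ?_⟩,
      rfl, Fin.castPred_castSucc _⟩
    · exact congrArg Subtype.val (coneVertex_injective j h)
    · exact congrArg Subtype.val (coneVertex_injective j h)

/-- The apex is never free, so exactly `a j` and `b j` are lost from `Γ j`. -/
lemma card_filter_fst_eq (hab : ∀ j, (a j : Fin n) ≠ b j) (j : Fin d) :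
    (Finset.univ.filter fun p : FreePoint (coneApex Γ) (fun j ↦ coneVertex Γ j (a j))
      (fun j ↦ coneVertex Γ j (b j)) ↦ p.1 = j).card + 2 = (Γ j).card := by
  have h1 := Finset.card_erase_add_one (a j).2
  have h2 := Finset.card_erase_add_one
    (Finset.mem_erase.mpr ⟨(hab j).symm, (b j).2⟩ : (b j : Fin n) ∈ (Γ j).erase (a j))
  rw [← image_baseVertex, Finset.card_image_of_injOn] at h2
  · rw [← h1, ← h2]
  · rintro ⟨j, x, hx⟩ h ⟨j', y, hy⟩ h' hxy
    obtain rfl : j = _ := by simpa using h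
    obtain rfl : j' = j := by simpa using h'
    have h3 := congrArg Fin.castSucc hxy
    rw [castSucc_baseVertex, castSucc_baseVertex] at h3
    obtain rfl : x = y := Subtype.ext h3
    rfl

lemma card_filter_fst_mem (hab : ∀ j, (a j : Fin n) ≠ b j) (S : Finset (Fin d)) :
    ((Finset.univ.filter fun p : FreePoint (coneApex Γ) (fun j ↦ coneVertex Γ j (a j))
      (fun j ↦ coneVertex Γ j (b j)) ↦ p.1 ∈ S).card : ℤ) = ∑ j ∈ S, (((Γ j).card : ℤ) - 2) := by
  rw [Finset.card_eq_sum_card_fiberwise (f := fun p ↦ p.1) (t := S)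
    (fun p hp ↦ by simpa using hp), Nat.cast_sum]
  refine Finset.sum_congr rfl fun j hj ↦ ?_
  rw [← card_filter_fst_eq hab j, Finset.filter_filter]
  have : ∀ p : FreePoint (coneApex Γ) (fun j ↦ coneVertex Γ j (a j))
      (fun j ↦ coneVertex Γ j (b j)), (p.1 ∈ S ∧ p.1 = j) ↔ p.1 = j :=
    fun p ↦ ⟨fun h ↦ h.2, fun h ↦ ⟨h ▸ hj, h⟩⟩
  simp only [this]
  push_cast
  ring

lemma card_freePoint_cone (hab : ∀ j, (a j : Fin n) ≠ b j) :
    (Fintype.card (FreePoint (coneApex Γ) (fun j ↦ coneVertex Γ j (a j))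
      (fun j ↦ coneVertex Γ j (b j))) : ℤ) = ∑ j, (((Γ j).card : ℤ) - 2) := by
  rw [← card_filter_fst_mem hab Finset.univ]
  simp

lemma pair_union_image_baseVertex (j : Fin d) :
    {(a j : Fin n), (b j : Fin n)} ∪ (Finset.univ.filter fun p : FreePoint (coneApex Γ)
      (fun j ↦ coneVertex Γ j (a j)) (fun j ↦ coneVertex Γ j (b j)) ↦ p.1 = j).image baseVertex =
      Γ j := by
  rw [image_baseVertex]
  ext i
  simp only [Finset.mem_union, Finset.mem_insert, Finset.mem_singleton, Finset.mem_erase]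
  constructor
  · rintro ((rfl | rfl) | h)
    exacts [(a j).2, (b j).2, h.2.2]
  · tauto

/-- Translates the Hall condition for similarity systems into the inequalities on the hypergraph.
The endpoints of a segment and its dividing points together make up `Γ j`, and each hyperedge
carries `|Γ j| - 2` ratios. -/
lemma hall_iff (hab : ∀ j, (a j : Fin n) ≠ b j) : (∀ S : Finset (Fin d), S.Nonempty →
    (Finset.univ.filter fun p : FreePoint (coneApex Γ) (fun j ↦ coneVertex Γ j (a j))
      (fun j ↦ coneVertex Γ j (b j)) ↦ p.1 ∈ S).card + 2 ≤
      (S.biUnion fun j ↦ {(a j : Fin n), (b j : Fin n)} ∪ (Finset.univ.filter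
        fun p : FreePoint (coneApex Γ) (fun j ↦ coneVertex Γ j (a j))
          (fun j ↦ coneVertex Γ j (b j)) ↦ p.1 = j).image baseVertex).card) ↔
    ∀ S : Finset (Fin d), S.Nonempty →
      ∑ j ∈ S, (((Γ j).card : ℤ) - 2) ≤ ((S.biUnion Γ).card : ℤ) - 2 := by
  refine forall₂_congr fun S hS ↦ ?_
  simp only [pair_union_image_baseVertex]
  rw [← card_filter_fst_mem hab S]
  lia

end Cones

/-- Charts of the hypergraph morphism of a cone in which it is given by normalising positions. -/
lemma exists_cone_chart (k : Type u) [Field k] {n d : ℕ} {Γ : Fin d → Finset (Fin n)}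
    {a b : ∀ j, Γ j} (hab : ∀ j, (a j : Fin n) ≠ b j) {α β : Fin n} (hαβ : α ≠ β) :
    ∃ (s : specOver k (LineRing k α β) ⟶ MBar k (Fin (n + 1)))
      (s' : specOver k (ParamRing k (coneApex Γ) (fun j ↦ coneVertex Γ j (a j))
        (fun j ↦ coneVertex Γ j (b j))) ⟶ ∏ᶜ fun j : Fin d ↦ MBar k (cone Γ j))
      (φ : ParamRing k (coneApex Γ) (fun j ↦ coneVertex Γ j (a j))
        (fun j ↦ coneVertex Γ j (b j)) →ₐ[k] LineRing k α β),
      IsOpenImmersion s.left ∧ IsDominant s.left ∧ IsOpenImmersion s'.left ∧ IsDominant s'.left ∧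
      s.left ≫ (hypergraphMorphism k (cone Γ)).left =
        Spec.map (CommRingCat.ofHom φ.toRingHom) ≫ s'.left ∧
      ∀ p : FreePoint (coneApex Γ) (fun j ↦ coneVertex Γ j (a j)) (fun j ↦ coneVertex Γ j (b j)),
        φ (paramPos k _ _ _ p.1 p.2) * (linePos k α β (b p.1) - linePos k α β (a p.1)) =
          linePos k α β (baseVertex p) - linePos k α β (a p.1) := by
  obtain ⟨s, s', φ, h1, h2, h3, h4, h5, h6⟩ := exists_hypergraph_chart k (cone Γ)
    (Fin.castSucc_ne_last α) (Fin.castSucc_ne_last β)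
    (fun h ↦ hαβ (Fin.castSucc_injective n h)) (coneApex Γ) (fun j ↦ coneVertex Γ j (a j))
    (fun j ↦ coneVertex Γ j (b j)) (fun _ ↦ rfl) (fun _ ↦ coneVertex_ne_coneApex _)
    (fun _ ↦ coneVertex_ne_coneApex _)
    (fun j h ↦ hab j (congrArg Subtype.val (coneVertex_injective j h)))
  refine ⟨s, s', φ, h1, h2, h3, h4, congrArg CommaMorphism.left h5, fun p ↦ ?_⟩
  have h7 := h6 p.1 p.2 p.2.2.1
  rw [← castSucc_baseVertex] at h7
  exact h7

end HypergraphMorphism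
end

/-! ### Dominance and birationality of the cone morphism -/

theorem theorem3p1 {k : Type u} [Field k] [IsAlgClosed k] (n d : ℕ) (hn : 2 ≤ n)
    (Γ : Fin d → Finset (Fin n)) (hΓ : ∀ j, 3 ≤ (Γ j).card) :
    (IsDominant (HypergraphMorphism.hypergraphMorphism k (HypergraphMorphism.cone Γ)).left ↔
      ∀ S : Finset (Fin d), S.Nonempty →
        ∑ j ∈ S, (((Γ j).card : ℤ) - 2) ≤ ((S.biUnion Γ).card : ℤ) - 2) ∧
    (HypergraphMorphism.IsBirational
        (HypergraphMorphism.hypergraphMorphism k (HypergraphMorphism.cone Γ)).left ↔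
      IsDominant (HypergraphMorphism.hypergraphMorphism k (HypergraphMorphism.cone Γ)).left ∧
        (n : ℤ) - 2 = ∑ j, (((Γ j).card : ℤ) - 2)) := by
  open HypergraphMorphism in
  have : Infinite k := IsAlgClosed.instInfinite
  have hpair (j : Fin d) : ∃ a b : Γ j, (a : Fin n) ≠ b := by
    obtain ⟨a, ha, b, hb, hab⟩ := Finset.one_lt_card.mp (lt_of_lt_of_le (by lia) (hΓ j))
    exact ⟨⟨a, ha⟩, ⟨b, hb⟩, hab⟩
  choose a b hab using hpair
  -- The two points that normalise the source may be arbitrary. They need not belong to a hyperedge.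
  obtain ⟨α, β, hαβ⟩ : ∃ α β : Fin n, α ≠ β := ⟨⟨0, by lia⟩, ⟨1, by lia⟩, by simp⟩
  have hab' (j : Fin d) : coneVertex Γ j (a j) ≠ coneVertex Γ j (b j) := fun h ↦
    hab j (congrArg Subtype.val (coneVertex_injective j h))
  obtain ⟨s, s', φ, h1, h2, h3, h4, hs, hφ⟩ := exists_cone_chart k hab hαβ
  have hB : IsDomain (LineRing k α β) :=
    isDomain_paramRing _ _ _ _ fun _ h ↦ hαβ (Fin.castSucc_injective n h)
  have hA := isDomain_paramRing k (coneApex Γ) _ _ hab'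
  have hdom : IsDominant (hypergraphMorphism k (cone Γ)).left ↔ Function.Injective φ :=
    isDominant_iff_injective hs
  have hhall := (injective_iff_hall hab' hαβ hab hφ).trans (hall_iff hab)
  have hcard := card_freePoint_cone hab
  rw [Fintype.card_eq_nat_card] at hcard
  refine ⟨hdom.trans hhall, fun hb ↦ ⟨hb.isDominant, ?_⟩, fun ⟨hd, hnd⟩ ↦ ?_⟩
  · have hle := card_le_of_exists_mul_eq hαβ (hb.exists_mul_eq hs)
    rw [Fintype.card_eq_nat_card] at hle
    refine le_antisymm (by omega) ?_
    -- The inequality for the set of all hyperedges bounds the sum by `n - 2`. Without hyperedges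
    -- that inequality is not available, and `2 ≤ n` takes its place.
    rcases (Finset.univ : Finset (Fin d)).eq_empty_or_nonempty with he | he
    · rw [he, Finset.sum_empty]
      lia
    · refine ((hdom.trans hhall).mp hb.isDominant _ he).trans ?_
      have := Finset.card_le_univ (Finset.univ.biUnion Γ)
      rw [Fintype.card_fin] at this
      lia
  · have hinj := hdom.mp hd
    refine isBirational_of_exists_mul_eq hs hinj ?_
      (exists_mul_eq_of_card_le hab' hαβ hab hφ hinj (by rw [Fintype.card_eq_nat_card]; omega))
    -- The source chart is of finite type over `k`, hence over any `k`-algebra mapping to it.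
    refine RingHom.FiniteType.of_comp_finiteType (f := algebraMap k _) ?_
    rw [AlgHom.toRingHom_eq_coe, φ.comp_algebraMap]
    exact RingHom.finiteType_algebraMap.mpr inferInstance
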